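/- **Theorem (Duality).** Let $N\ge 1$ be an integer, let $s,\lambda_L,\lambda_R>0$, and write $\mathbb R_+=(0,\infty)$, $\mathbb N=\{0,1,2,\dots\}$; $\delta_i$ denotes the $i$-th unit vector. *Heat conduction process.* For $f$ a function of $y\in\mathbb R_+^N$ put $$\mathscr L f=\mathscr L_1 f+\sum_{i=1}^{N-1}\mathscr L_{i,i+1}f+\mathscr L_N f ,$$ where, for $1\le i\le N-1$, $$\mathscr L_{i,i+1}f(y)=\int_0^{y_i}\frac{d\alpha}{\alpha}\Big(1-\frac{\alpha}{y_i}\Big)^{2s-1}\big[f(y-\alpha\delta_i+\alpha\delta_{i+1})-f(y)\big]+\int_0^{y_{i+1}}\frac{d\alpha}{\alpha}\Big(1-\frac{\alpha}{y_{i+1}}\Big)^{2s-1}\big[f(y+\alpha\delta_i-\alpha\delta_{i+1})-f(y)\big],$$ $$\mathscr L_{1}f(y)=\int_0^{y_1}\frac{d\alpha}{\alpha}\Big(1-\frac{\alpha}{y_1}\Big)^{2s-1}\big[f(y-\alpha\delta_1)-f(y)\big]+\int_0^{\infty}\frac{d\alpha}{\alpha}e^{-\lambda_L\alpha}\big[f(y+\alpha\delta_1)-f(y)\big],$$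 and $\mathscr L_N$ is given by the formula for $\mathscr L_1$ with $y_1,\delta_1,\lambda_L$ replaced by $y_N,\delta_N,\lambda_R$. Let $\{y(t):t\ge 0\}$ be a process with generator $\mathscr L$ started from $y\in\mathbb R_+^N$: a càdlàg adapted process with values in $\mathbb R_+^N$ and $y(0)=y$ almost surely such that $f(y(t))-\int_0^t\mathscr Lf(y(r))\,dr$ is a martingale for every smooth compactly supported $f:\mathbb R^N\to\mathbb R$. *Dual absorbing process.* For $k,m\in\mathbb N$ put $$\varphi_s(k,m)=\frac1k\,\frac{\Gamma(m+1)\,\Gamma(m-k+2s)}{\Gamma(m-k+1)\,\Gamma(m+2s)}\quad\text{if }1\le k\le m,\qquad \varphi_s(k,m)=0\ \text{ otherwise},$$ and for $f:\mathbb N^{N+2}\to\mathbb R$ and $\xi=(\xi_0,\dots,\xi_{N+1})$, $$\mathscr L^{\mathrm{dual}}f(\xi)=\sum_{(a,b)}\ \sum_{k=1}^{\xi_a}\varphi_s(k,\xi_a)\big[f(\xi-k\delta_a+k\delta_b)-f(\xi)\big],$$ the outer sum running over the ordered pairs $(1,0)$, $(N,N+1)$ and $(i,i+1)$, $(i+1,i)$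 with $1\le i\le N-1$. Let $\{\xi(t):t\ge0\}$ be a process with generator $\mathscr L^{\mathrm{dual}}$ started from $\xi\in\mathbb N^{N+2}$: a càdlàg adapted process on $\mathbb N^{N+2}$ with $\xi(0)=\xi$ almost surely such that $f(\xi(t))-\int_0^t\mathscr L^{\mathrm{dual}}f(\xi(r))\,dr$ is a martingale for every finitely supported $f$. *Claim.* Let $$D(y,\xi)=\Big(\frac1{\lambda_L}\Big)^{\xi_0}\Big(\prod_{i=1}^N y_i^{\xi_i}\,\frac{\Gamma(2s)}{\Gamma(2s+\xi_i)}\Big)\Big(\frac1{\lambda_R}\Big)^{\xi_{N+1}} .$$ Then for every $t\ge0$ and all $(y,\xi)\in\mathbb R_+^N\times\mathbb N^{N+2}$ the random variables $D(y(t),\xi)$ and $D(y,\xi(t))$ are integrable, and $$\mathbb E_y\big[D(y(t),\xi)\big]=\mathbb E_\xi\big[D(y,\xi(t))\big],$$ where on the left the process $y(t)$ is started from $y$ and on the right the process $\xi(t)$ is started from $\xi$. -/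

import Mathlib

open MeasureTheory Filter Topology
open scoped NNReal

noncomputable section

/-! The number of bulk sites is `N = n + 1` with `n : ℕ`, so that `N ≥ 1`.  The bulk sites
`1, …, N` are indexed by `Fin (n + 1)`, and the extended lattice `0, 1, …, N + 1` of the dual
process by `Fin (n + 3)`. -/

/-! ### Generator of the heat conduction model -/

/-- Movement of energy from site `i` to site `j`:
`∫_0^{y_i} dα/α (1 - α/y_i)^{2s-1} [f(y - α δ_i + α δ_j) - f(y)]`. -/
def energyTransfer {N : ℕ} (s : ℝ) (i j : Fin N) (f : (Fin N → ℝ) → ℝ) (y : Fin N → ℝ) : ℝ :=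
  ∫ α in (0 : ℝ)..y i,
    1 / α * (1 - α / y i) ^ (2 * s - 1) * (f (y - Pi.single i α + Pi.single j α) - f y)

/-- Removal of energy from site `i` by a reservoir:
`∫_0^{y_i} dα/α (1 - α/y_i)^{2s-1} [f(y - α δ_i) - f(y)]`. -/
def energyRemoval {N : ℕ} (s : ℝ) (i : Fin N) (f : (Fin N → ℝ) → ℝ) (y : Fin N → ℝ) : ℝ :=
  ∫ α in (0 : ℝ)..y i,
    1 / α * (1 - α / y i) ^ (2 * s - 1) * (f (y - Pi.single i α) - f y)

/-- Injection of energy into site `i` by a reservoir of parameter `lam`: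
`∫_0^∞ dα/α e^{-lam α} [f(y + α δ_i) - f(y)]`. -/
def energyInjection {N : ℕ} (lam : ℝ) (i : Fin N) (f : (Fin N → ℝ) → ℝ) (y : Fin N → ℝ) : ℝ :=
  ∫ α in Set.Ioi (0 : ℝ),
    1 / α * Real.exp (-lam * α) * (f (y + Pi.single i α) - f y)

/-- The generator `ℒ = ℒ_1 + ∑_{i=1}^{N-1} ℒ_{i,i+1} + ℒ_N` of the boundary driven heat
conduction model. -/
def heatGenerator {n : ℕ} (s lamL lamR : ℝ) (f : (Fin (n + 1) → ℝ) → ℝ)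
    (y : Fin (n + 1) → ℝ) : ℝ :=
  (energyRemoval s 0 f y + energyInjection lamL 0 f y)
    + (∑ i : Fin n, (energyTransfer s i.castSucc i.succ f y
        + energyTransfer s i.succ i.castSucc f y))
    + (energyRemoval s (Fin.last n) f y + energyInjection lamR (Fin.last n) f y)

/-! ### Generator of the absorbing dual process -/

/-- The rates `φ_s(k, m)`; they vanish unless `1 ≤ k ≤ m`. -/
def harmonicRate (s : ℝ) (k m : ℕ) : ℝ :=
  if 1 ≤ k ∧ k ≤ m then
    1 / (k : ℝ) * (Real.Gamma ((m : ℝ) + 1) * Real.Gamma ((m : ℝ) - k + 2 * s))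
      / (Real.Gamma ((m : ℝ) - k + 1) * Real.Gamma ((m : ℝ) + 2 * s))
  else 0

/-- Jumps of particles from site `a` to site `b`:
`∑_{k=1}^{ξ_a} φ_s(k, ξ_a) [f(ξ - k δ_a + k δ_b) - f(ξ)]`. -/
def particleTransfer {M : ℕ} (s : ℝ) (a b : Fin M) (f : (Fin M → ℕ) → ℝ) (ξ : Fin M → ℕ) : ℝ :=
  ∑ k ∈ Finset.Icc 1 (ξ a),
    harmonicRate s k (ξ a) * (f (ξ - Pi.single a k + Pi.single b k) - f ξ)

/-- The position in the extended lattice `{0, …, N + 1}` of a bulk site. -/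
def bulkSite {n : ℕ} (i : Fin (n + 1)) : Fin (n + 3) := i.castSucc.succ

/-- The generator `ℒ^dual = ℒ^dual_{0,1} + ∑_{i=1}^{N-1} ℒ^dual_{i,i+1} + ℒ^dual_{N,N+1}` of the
absorbing dual process. -/
def dualGenerator {n : ℕ} (s : ℝ) (f : (Fin (n + 3) → ℕ) → ℝ) (ξ : Fin (n + 3) → ℕ) : ℝ :=
  particleTransfer s (bulkSite (0 : Fin (n + 1))) 0 f ξ
    + (∑ i : Fin n, (particleTransfer s (bulkSite i.castSucc) (bulkSite i.succ) f ξ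
        + particleTransfer s (bulkSite i.succ) (bulkSite i.castSucc) f ξ))
    + particleTransfer s (bulkSite (Fin.last n)) (Fin.last (n + 2)) f ξ

/-! ### Processes with a given generator -/

/-- A path is càdlàg: right-continuous with left limits. -/
def IsCadlagPath {E : Type*} [TopologicalSpace E] (x : ℝ≥0 → E) : Prop :=
  ∀ t : ℝ≥0, ContinuousWithinAt x (Set.Ici t) t ∧ ∃ l : E, Tendsto x (𝓝[<] t) (𝓝 l)

/-- `X` is a càdlàg adapted process started from `x` which solves the martingale problem for the
operator `A` with the set `𝒟` of test functions: for every `f ∈ 𝒟`,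
`f(X_t) - ∫_0^t (A f)(X_r) dr` is a martingale. -/
structure IsMartingaleSolution {Ω E : Type*} {mΩ : MeasurableSpace Ω} [MeasurableSpace E]
    [TopologicalSpace E] (P : Measure Ω) (ℱ : Filtration ℝ≥0 mΩ) (X : ℝ≥0 → Ω → E)
    (𝒟 : Set (E → ℝ)) (A : (E → ℝ) → E → ℝ) (x : E) : Prop where
  adapted : ∀ t, Measurable[ℱ t] (X t)
  cadlag : ∀ ω, IsCadlagPath (fun t => X t ω)
  start : ∀ᵐ ω ∂P, X 0 ω = x
  martingale : ∀ f ∈ 𝒟,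
    Martingale (fun (t : ℝ≥0) ω => f (X t ω) - ∫ r in (0 : ℝ)..t, A f (X r.toNNReal ω)) ℱ P

/-- `Y` is a heat conduction process `y(t)` started from `y`: it takes values in `(0, ∞)^N` and
solves the martingale problem for the generator `ℒ`, the test functions being the restrictions of
the smooth compactly supported functions on `ℝ^N`. -/
structure IsHeatProcess {n : ℕ} {Ω : Type*} {mΩ : MeasurableSpace Ω} (s lamL lamR : ℝ)
    (P : Measure Ω) (ℱ : Filtration ℝ≥0 mΩ) (Y : ℝ≥0 → Ω → Fin (n + 1) → ℝ)
    (y : Fin (n + 1) → ℝ) : Prop where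
  pos : ∀ t ω i, 0 < Y t ω i
  solution : IsMartingaleSolution P ℱ Y {f | ContDiff ℝ (⊤ : ℕ∞) f ∧ HasCompactSupport f}
    (heatGenerator s lamL lamR) y

/-- `X` is an absorbing dual process `ξ(t)` started from `ξ`: it solves the martingale problem for
the generator `ℒ^dual`, the test functions being the finitely supported functions. -/
def IsDualProcess {n : ℕ} {Ω : Type*} {mΩ : MeasurableSpace Ω} (s : ℝ)
    (P : Measure Ω) (ℱ : Filtration ℝ≥0 mΩ) (X : ℝ≥0 → Ω → Fin (n + 3) → ℕ)
    (ξ : Fin (n + 3) → ℕ) : Prop :=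
  IsMartingaleSolution P ℱ X {f | (Function.support f).Finite} (dualGenerator s) ξ

/-! ### The duality function -/

/-- `D(y, ξ) = (1/λ_L)^{ξ_0} ∏_{i=1}^N (y_i^{ξ_i} Γ(2s) / Γ(2s + ξ_i)) (1/λ_R)^{ξ_{N+1}}`. -/
def dualityFunction {n : ℕ} (s lamL lamR : ℝ) (y : Fin (n + 1) → ℝ) (ξ : Fin (n + 3) → ℕ) : ℝ :=
  (1 / lamL) ^ ξ 0
    * (∏ i : Fin (n + 1), y i ^ ξ (bulkSite i)
        * (Real.Gamma (2 * s) / Real.Gamma (2 * s + ξ (bulkSite i))))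
    * (1 / lamR) ^ ξ (Fin.last (n + 2))

end

/-! The heart is an identity between generators: `ℒ` acting on `D(·, ξ)` at `y` equals `ℒ^dual`
acting on `D(y, ·)` at `ξ` (`jumpSum_dualityFunction`). Since `D` is polynomial in `y`, the binomial
theorem splits the jump integrals into Beta and Gamma integrals. The normalization `Γ(2s)/Γ(2s+m)`
turns the term of order `k` into the rate of a dual jump of `k` particles against the direction of
the energy flow, and a particle absorbed by a reservoir of parameter `λ` leaves a factor `1/λ`.

The dual jumps conserve the number of particles, so only the finite set `S` of configurations with
as many particles as `ξ` matters. On `S` the functions `h η t = E_y D(y(t), η)` solve the backward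
linear system of a finite matrix, and the probabilities `p η t` of `ξ(t) = η` solve the forward
system of the same matrix. Hence `∑ η ∈ S, p η (T - r) * h η r` does not depend on `r`
(`sum_mul_eq_of_linear_systems`); its values at `r = T` and `r = 0` are the two sides of the claim.
No uniqueness for either martingale problem is needed.

The analytic work is to apply Dynkin's formula to `D(·, η)`, which is not compactly supported. For
`θ` below both reservoir parameters, `exp (θ * totalEnergy)` is a Lyapunov function, so the total
energy has an exponential moment that is bounded on bounded time intervals
(`integral_exp_totalEnergy_le`). Cutting off a polynomial and letting the cutoff recede then passes
to the limit by dominated convergence (`dynkin_of_tendsto`, `dynkin_of_polyLipschitz`). On the dual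
side point masses are test functions, and conservation of particles along the process follows from
the same pairing with `h = 1`. -/

/-- A process with right-continuous paths is jointly measurable. -/
theorem measurable_uncurry_of_right_continuous {Ω E : Type*} [MeasurableSpace Ω]
    [TopologicalSpace E] [TopologicalSpace.PseudoMetrizableSpace E] [MeasurableSpace E]
    [BorelSpace E] {X : ℝ≥0 → Ω → E} (hm : ∀ t, Measurable (X t))
    (hc : ∀ ω t, ContinuousWithinAt (fun r => X r ω) (Set.Ici t) t) :
    Measurable (fun p : ℝ≥0 × Ω => X p.1 p.2) := by
  -- The point of the grid of mesh `1 / (k + 1)` just to the right of `r`: it takes countably many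
  -- values and approaches `r` from the side on which the paths are continuous.
  let d : ℕ → ℝ≥0 → ℝ≥0 := fun k r => ((⌊((k : ℝ≥0) + 1) * r⌋₊ : ℝ≥0) + 1) / ((k : ℝ≥0) + 1)
  have hlow : ∀ k r, r ≤ d k r := by
    intro k r
    have hk : (0 : ℝ≥0) < (k : ℝ≥0) + 1 := by positivity
    rw [le_div_iff₀ hk, mul_comm]
    exact (Nat.lt_floor_add_one _).le
  have hupp : ∀ k r, d k r ≤ r + 1 / ((k : ℝ≥0) + 1) := by
    intro k r
    have hk : (0 : ℝ≥0) < (k : ℝ≥0) + 1 := by positivity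
    rw [div_le_iff₀ hk, add_mul r, one_div, inv_mul_cancel₀ hk.ne', mul_comm r]
    gcongr
    exact Nat.floor_le (by positivity)
  refine measurable_of_tendsto_metrizable (f := fun k (p : ℝ≥0 × Ω) => X (d k p.1) p.2)
    (fun k => ?_) ?_
  · have h1 : Measurable (fun q : ℕ × Ω => X (((q.1 : ℝ≥0) + 1) / ((k : ℝ≥0) + 1)) q.2) :=
      measurable_from_prod_countable_right fun j => hm (((j : ℝ≥0) + 1) / ((k : ℝ≥0) + 1))
    have h2 : Measurable (fun p : ℝ≥0 × Ω => (⌊((k : ℝ≥0) + 1) * p.1⌋₊, p.2)) :=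
      (Nat.measurable_floor.comp (measurable_fst.const_mul _)).prodMk measurable_snd
    have h3 := h1.comp h2
    simp only [Function.comp_def] at h3
    exact h3
  · rw [tendsto_pi_nhds]
    rintro ⟨r, ω⟩
    have hd : Tendsto (fun k => d k r) atTop (𝓝 r) := by
      refine tendsto_of_tendsto_of_tendsto_of_le_of_le tendsto_const_nhds ?_
        (fun k => hlow k r) (fun k => hupp k r)
      have : Tendsto (fun k : ℕ => r + 1 / ((k : ℝ≥0) + 1)) atTop (𝓝 (r + 0)) :=
        tendsto_const_nhds.add tendsto_one_div_add_atTop_nhds_zero_nat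
      simpa using this
    exact (hc ω r).tendsto.comp
      (tendsto_nhdsWithin_iff.2 ⟨hd, Eventually.of_forall fun k => hlow k r⟩)

/-! ### Dynkin's formula for solutions of a martingale problem -/

section MartingaleSolution

variable {Ω E : Type*} {mΩ : MeasurableSpace Ω} [MeasurableSpace E] [TopologicalSpace E]
  {P : Measure Ω} {ℱ : Filtration ℝ≥0 mΩ} {X : ℝ≥0 → Ω → E}
  {𝒟 : Set (E → ℝ)} {A : (E → ℝ) → E → ℝ} {x : E}

theorem IsMartingaleSolution.measurable (h : IsMartingaleSolution P ℱ X 𝒟 A x) (t : ℝ≥0) :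
    Measurable (X t) :=
  (h.adapted t).mono (ℱ.le t) le_rfl

variable [TopologicalSpace.PseudoMetrizableSpace E] [BorelSpace E]

theorem IsMartingaleSolution.measurable_uncurry (h : IsMartingaleSolution P ℱ X 𝒟 A x) :
    Measurable (fun p : ℝ × Ω => X p.1.toNNReal p.2) :=
  (measurable_uncurry_of_right_continuous h.measurable fun ω t => (h.cadlag ω t).1).comp
    ((measurable_real_toNNReal.comp measurable_fst).prodMk measurable_snd)

variable [IsProbabilityMeasure P]

/-- Dynkin's formula for a test function with bounded image under the generator. -/
theorem IsMartingaleSolution.integral_eq (h : IsMartingaleSolution P ℱ X 𝒟 A x) {f g : E → ℝ}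
    (hf : f ∈ 𝒟) (hg : Measurable g) (hfg : ∀ r ω, A f (X r ω) = g (X r ω)) {C : ℝ}
    (hb : ∀ r ω, |g (X r ω)| ≤ C) (t : ℝ≥0) :
    Integrable (fun ω => f (X t ω)) P ∧
      ∫ ω, f (X t ω) ∂P = f x + ∫ r in (0 : ℝ)..t, ∫ ω, g (X r.toNNReal ω) ∂P := by
  have hM := h.martingale f hf
  -- The generator enters only through its values along the path, so it may be traded for the
  -- measurable function `g`.
  simp only [hfg] at hM
  have hgm : Measurable (fun p : ℝ × Ω => g (X p.1.toNNReal p.2)) := hg.comp h.measurable_uncurry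
  have hint : Integrable (fun p : ℝ × Ω => g (X p.1.toNNReal p.2))
      ((volume.restrict (Set.Ioc 0 (t : ℝ))).prod P) :=
    Integrable.of_bound hgm.aestronglyMeasurable C (Eventually.of_forall fun p => hb _ _)
  have hI : Integrable (fun ω => ∫ r in (0 : ℝ)..t, g (X r.toNNReal ω)) P := by
    simp only [intervalIntegral.integral_of_le t.coe_nonneg]
    exact hint.integral_prod_right
  have hft : Integrable (fun ω => f (X t ω)) P := by
    have := (hM.integrable t).add hI
    refine this.congr (Eventually.of_forall fun ω => ?_)
    simp
  refine ⟨hft, ?_⟩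
  have h0 := hM.setIntegral_eq (zero_le : 0 ≤ t) (MeasurableSet.univ)
  simp only [Measure.restrict_univ, NNReal.coe_zero, intervalIntegral.integral_same, sub_zero] at h0
  have hstart : ∫ ω, f (X 0 ω) ∂P = f x := by
    rw [integral_congr_ae (g := fun _ => f x) (h.start.mono fun ω hω => by simp only [hω])]
    simp
  have hfub : ∫ ω, (∫ r in (0 : ℝ)..t, g (X r.toNNReal ω)) ∂P
      = ∫ r in (0 : ℝ)..t, ∫ ω, g (X r.toNNReal ω) ∂P := by
    simp only [intervalIntegral.integral_of_le t.coe_nonneg]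
    exact (integral_integral_swap hint).symm
  rw [integral_sub hft hI, hstart, hfub] at h0
  linarith

theorem IsMartingaleSolution.measurable_integral (h : IsMartingaleSolution P ℱ X 𝒟 A x) {g : E → ℝ}
    (hg : Measurable g) : Measurable (fun r : ℝ => ∫ ω, g (X r.toNNReal ω) ∂P) :=
  ((hg.comp h.measurable_uncurry).stronglyMeasurable.integral_prod_right').measurable

end MartingaleSolution

/-! ### Integral equations: Grönwall, regularity, transposed linear systems -/

/-- Grönwall's inequality in integral form. -/
theorem le_mul_exp_of_le_add_integral {m : ℝ → ℝ} {a C T : ℝ} (hT : 0 ≤ T) (hC : 0 ≤ C)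
    (hm : ContinuousOn m (Set.Icc 0 T))
    (h : ∀ t ∈ Set.Icc 0 T, m t ≤ a + C * ∫ r in (0 : ℝ)..t, m r) : m T ≤ a * Real.exp (C * T) := by
  -- The differential Grönwall inequality is applied to the right-hand side `φ`, whose right
  -- derivative `C * m` is at most `C * φ`; `m` itself need not be differentiable.
  set φ : ℝ → ℝ := fun t => a + C * ∫ r in (0 : ℝ)..t, m r with hφ
  have hcont : ContinuousOn φ (Set.Icc 0 T) := by
    have := intervalIntegral.continuousOn_primitive_interval (a := 0) (b := T) (f := m)
      (μ := volume) ((hm.integrableOn_Icc).mono_set (by rw [Set.uIcc_of_le hT]))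
    rw [Set.uIcc_of_le hT] at this
    exact continuousOn_const.add (continuousOn_const.mul this)
  have hder : ∀ x ∈ Set.Ico 0 T, HasDerivWithinAt φ (C * m x) (Set.Ici x) x := by
    intro x hx
    have hxi : IntervalIntegrable m volume 0 x :=
      (hm.mono (Set.Icc_subset_Icc_right hx.2.le)).intervalIntegrable_of_Icc hx.1
    have hsm : StronglyMeasurableAtFilter m (𝓝[Set.Ioi x] x) :=
      ⟨Set.Ioc x T, Ioc_mem_nhdsGT hx.2, ((hm.mono (Set.Ioc_subset_Icc_self.trans
        (Set.Icc_subset_Icc_left hx.1))).aestronglyMeasurable measurableSet_Ioc)⟩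
    have hcx : ContinuousWithinAt m (Set.Ioi x) x :=
      ((hm x ⟨hx.1, hx.2.le⟩).mono_of_mem_nhdsWithin (s := Set.Ioi x)
        (mem_of_superset (Ioc_mem_nhdsGT hx.2) (fun z hz => ⟨hx.1.trans hz.1.le, hz.2⟩)))
    have := intervalIntegral.integral_hasDerivWithinAt_right (s := Set.Ici x) (t := Set.Ioi x)
      hxi hsm hcx
    exact (this.const_mul C).const_add a
  have key := le_gronwallBound_of_liminf_deriv_right_le (f := φ) (f' := fun x => C * m x)
    (δ := a) (K := C) (ε := 0) hcont
    (fun x hx r hr => (hder x hx).liminf_right_slope_le hr) (by simp [hφ])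
    (fun x hx => by
      simp only [add_zero]
      exact mul_le_mul_of_nonneg_left (h x ⟨hx.1, hx.2.le⟩) hC) T ⟨hT, le_rfl⟩
  rw [gronwallBound_ε0, sub_zero] at key
  exact (h T ⟨hT, le_rfl⟩).trans key

/-- First half of a bootstrap: an integrable solution of a linear integral system is continuous, so
its integrand is continuous, and the next lemma makes the solution differentiable. -/
theorem continuousOn_of_eq_add_integral {m g : ℝ → ℝ} {a T : ℝ} (hT : 0 ≤ T)
    (hg : IntegrableOn g (Set.Icc 0 T))
    (h : ∀ t ∈ Set.Icc 0 T, m t = a + ∫ r in (0 : ℝ)..t, g r) : ContinuousOn m (Set.Icc 0 T) := by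
  have := intervalIntegral.continuousOn_primitive_interval (a := 0) (b := T) (f := g)
    (by rwa [Set.uIcc_of_le hT])
  rw [Set.uIcc_of_le hT] at this
  exact (continuousOn_const.add this).congr h

theorem hasDerivAt_of_eq_add_integral {m g : ℝ → ℝ} {a T : ℝ}
    (hg : ContinuousOn g (Set.Icc 0 T))
    (h : ∀ t ∈ Set.Icc 0 T, m t = a + ∫ r in (0 : ℝ)..t, g r) {t : ℝ} (ht : t ∈ Set.Ioo 0 T) :
    HasDerivAt m (g t) t := by
  have hxi : IntervalIntegrable g volume 0 t :=
    (hg.mono (Set.Icc_subset_Icc_right ht.2.le)).intervalIntegrable_of_Icc ht.1.le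
  have hsm : StronglyMeasurableAtFilter g (𝓝 t) :=
    ⟨Set.Ioo 0 T, Ioo_mem_nhds ht.1 ht.2,
      (hg.mono Set.Ioo_subset_Icc_self).aestronglyMeasurable measurableSet_Ioo⟩
  have hc : ContinuousAt g t := hg.continuousAt (Icc_mem_nhds ht.1 ht.2)
  refine ((intervalIntegral.integral_hasDerivAt_right hxi hsm hc).const_add a).congr_of_eventuallyEq ?_
  filter_upwards [Ioo_mem_nhds ht.1 ht.2] with z hz using h z (Set.Ioo_subset_Icc_self hz)

/-- If `p` solves the forward and `h` the backward linear system of a matrix, then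
`r ↦ ∑ η, p η (T - r) * h η r` takes the same value at the two endpoints. -/
theorem sum_mul_eq_of_linear_systems {ι : Type*} (S : Finset ι) (ℓ : ι → ι → ℝ) {p h : ι → ℝ → ℝ}
    {T : ℝ} (hT : 0 ≤ T) (hpi : ∀ η ∈ S, IntegrableOn (p η) (Set.Icc 0 T))
    (hhi : ∀ η ∈ S, IntegrableOn (h η) (Set.Icc 0 T))
    (hp : ∀ η ∈ S, ∀ t ∈ Set.Icc 0 T,
      p η t = p η 0 + ∫ r in (0 : ℝ)..t, ∑ ζ ∈ S, p ζ r * ℓ ζ η)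
    (hh : ∀ η ∈ S, ∀ t ∈ Set.Icc 0 T,
      h η t = h η 0 + ∫ r in (0 : ℝ)..t, ∑ ζ ∈ S, ℓ η ζ * h ζ r) :
    ∑ η ∈ S, p η 0 * h η T = ∑ η ∈ S, p η T * h η 0 := by
  have hpc : ∀ η ∈ S, ContinuousOn (p η) (Set.Icc 0 T) := fun η hη =>
    continuousOn_of_eq_add_integral hT
      (integrable_finsetSum _ fun ζ hζ => (hpi ζ hζ).mul_const _) (hp η hη)
  have hhc : ∀ η ∈ S, ContinuousOn (h η) (Set.Icc 0 T) := fun η hη =>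
    continuousOn_of_eq_add_integral hT
      (integrable_finsetSum _ fun ζ hζ => (hhi ζ hζ).const_mul _) (hh η hη)
  rcases hT.eq_or_lt with rfl | hT'
  · rfl
  have hrefl : Set.MapsTo (fun r => T - r) (Set.Icc 0 T) (Set.Icc 0 T) := fun r hr =>
    ⟨by linarith [hr.2], by linarith [hr.1]⟩
  set q : ℝ → ℝ := fun r => ∑ η ∈ S, p η (T - r) * h η r with hq
  have hqc : ContinuousOn q (Set.Icc 0 T) := continuousOn_finsetSum _ fun η hη =>
    ((hpc η hη).comp (by fun_prop) hrefl).mul (hhc η hη)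
  have hqd : ∀ r ∈ Set.Ioo 0 T, HasDerivAt q 0 r := by
    intro r hr
    have hr' : T - r ∈ Set.Ioo 0 T := ⟨by linarith [hr.2], by linarith [hr.1]⟩
    have hd : HasDerivAt q (∑ η ∈ S, ((∑ ζ ∈ S, p ζ (T - r) * ℓ ζ η) * (-1) * h η r
        + p η (T - r) * ∑ ζ ∈ S, ℓ η ζ * h ζ r)) r := by
      refine HasDerivAt.fun_sum fun η hη => ?_
      have h1 := hasDerivAt_of_eq_add_integral
        (continuousOn_finsetSum _ fun ζ hζ => (hpc ζ hζ).mul continuousOn_const) (hp η hη) hr'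
      have h2 := hasDerivAt_of_eq_add_integral
        (continuousOn_finsetSum _ fun ζ hζ => continuousOn_const.mul (hhc ζ hζ)) (hh η hη) hr
      exact (h1.comp r ((hasDerivAt_id r).const_sub T)).mul h2
    -- Reversing time in `p` produces a minus sign, and the two double sums cancel after exchanging
    -- the indices.
    convert hd using 1
    rw [Finset.sum_add_distrib]
    simp only [Finset.sum_mul, Finset.mul_sum]
    rw [Finset.sum_comm, ← Finset.sum_add_distrib]
    refine (Finset.sum_eq_zero fun η _ => ?_).symm
    rw [← Finset.sum_add_distrib]
    exact Finset.sum_eq_zero fun ζ _ => by ring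
  -- The derivative is known only in the open interval; continuity up to the endpoints and the mean
  -- value theorem do the rest.
  obtain ⟨c, hc, hs⟩ := exists_deriv_eq_slope q hT' hqc
    (fun r hr => (hqd r hr).differentiableAt.differentiableWithinAt)
  rw [(hqd c hc).deriv, eq_comm, div_eq_zero_iff] at hs
  rcases hs with hs | hs
  · have := sub_eq_zero.1 hs
    simpa [hq] using this
  · linarith

/-! ### Jump operators on the orthant -/

section JumpChannel

variable {ι : Type*} [Fintype ι]

/-- The total energy of a configuration. -/
def totalEnergy (y : ι → ℝ) : ℝ := ∑ i, y i

theorem totalEnergy_nonneg {y : ι → ℝ} (hy : 0 ≤ y) : 0 ≤ totalEnergy y :=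
  Finset.sum_nonneg fun i _ => hy i

theorem le_totalEnergy {y : ι → ℝ} (hy : 0 ≤ y) (i : ι) : y i ≤ totalEnergy y :=
  Finset.single_le_sum (f := y) (fun j _ => hy j) (Finset.mem_univ i)

@[fun_prop]
theorem continuous_totalEnergy : Continuous (totalEnergy : (ι → ℝ) → ℝ) := by
  unfold totalEnergy; fun_prop

@[fun_prop]
theorem contDiff_totalEnergy {k : WithTop ℕ∞} : ContDiff ℝ k (totalEnergy : (ι → ℝ) → ℝ) := by
  unfold totalEnergy; fun_prop

theorem norm_le_totalEnergy {y : ι → ℝ} (hy : 0 ≤ y) : ‖y‖ ≤ totalEnergy y := by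
  refine (pi_norm_le_iff_of_nonneg (totalEnergy_nonneg hy)).2 fun i => ?_
  rw [Real.norm_of_nonneg (hy i)]
  exact le_totalEnergy hy i

/-- The jump operator `f ↦ ∫_0^∞ w(u) [f(T(y, u)) - f(y)] du`. -/
noncomputable def jumpOperator (w : ℝ → ℝ) (T : (ι → ℝ) → ℝ → ι → ℝ) (f : (ι → ℝ) → ℝ) (y : ι → ℝ) : ℝ :=
  ∫ u in Set.Ioi (0 : ℝ), w u * (f (T y u) - f y)

/-- Admissible jump rates `w` and jump maps `T`: the jumps preserve the orthant, displace a
configuration by at most `u` times its size, and have an exponential moment of order `θ`. -/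
structure IsJumpChannel (θ : ℝ) (w : ℝ → ℝ) (T : (ι → ℝ) → ℝ → ι → ℝ) : Prop where
  measurable_weight : Measurable w
  weight_nonneg : ∀ u, 0 < u → 0 ≤ w u
  integrable : IntegrableOn (fun u => w u * (u * Real.exp (θ * u))) (Set.Ioi 0)
  measurable_jump : Measurable (fun p : (ι → ℝ) × ℝ => T p.1 p.2)
  jump_nonneg : ∀ y u, 0 ≤ y → 0 < u → w u ≠ 0 → 0 ≤ T y u
  total_le : ∀ y u, 0 ≤ y → 0 < u → totalEnergy (T y u) ≤ totalEnergy y + u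
  total_ge : ∀ y u, 0 ≤ y → 0 < u → totalEnergy y - u * totalEnergy y ≤ totalEnergy (T y u)
  norm_sub_le : ∀ y u, 0 ≤ y → 0 < u → ‖T y u - y‖ ≤ u * (1 + totalEnergy y)

/-- The exponential moment of the jump rates. -/
noncomputable def jumpMoment (θ : ℝ) (w : ℝ → ℝ) : ℝ :=
  ∫ u in Set.Ioi (0 : ℝ), w u * (u * Real.exp (θ * u))

/-- Functions on the orthant whose local Lipschitz constants grow exponentially. -/
def ExpLipschitz (K κ : ℝ) (f : (ι → ℝ) → ℝ) : Prop :=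
  ∀ a b, 0 ≤ a → 0 ≤ b → |f a - f b| ≤ K * ‖a - b‖ * Real.exp (κ * (totalEnergy a + totalEnergy b))

variable {θ κ K : ℝ} {w : ℝ → ℝ} {T : (ι → ℝ) → ℝ → ι → ℝ} {f g : (ι → ℝ) → ℝ} {y : ι → ℝ}

namespace IsJumpChannel

theorem moment_nonneg (h : IsJumpChannel θ w T) : 0 ≤ jumpMoment θ w :=
  setIntegral_nonneg measurableSet_Ioi fun u hu =>
    mul_nonneg (h.weight_nonneg u hu) (mul_nonneg (le_of_lt hu) (Real.exp_pos _).le)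

/-- The Lipschitz bound supplies the factor `u` that tames a singularity of `w` at `0`. As a jump
raises the energy by at most `u`, the growth of the Lipschitz constant costs at most `exp (θ * u)`.
This is the dominating function for the limits below. -/
theorem integrand_le (h : IsJumpChannel θ w T) (hκ : 0 ≤ κ) (hκθ : κ ≤ θ) (hK : 0 ≤ K)
    (hf : ExpLipschitz K κ f) (hy : 0 ≤ y) {u : ℝ} (hu : 0 < u) :
    ‖w u * (f (T y u) - f y)‖
      ≤ K * (1 + totalEnergy y) * Real.exp (2 * κ * totalEnergy y)
        * (w u * (u * Real.exp (θ * u))) := by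
  have hS := totalEnergy_nonneg hy
  -- Jumps of rate zero may leave the orthant, where nothing is assumed about `f`.
  by_cases hw : w u = 0
  · simp [hw]
  have hw0 := h.weight_nonneg u hu
  have h1 := hf (T y u) y (h.jump_nonneg y u hy hu hw) hy
  have h2 := h.norm_sub_le y u hy hu
  have h3 : Real.exp (κ * (totalEnergy (T y u) + totalEnergy y))
      ≤ Real.exp (2 * κ * totalEnergy y) * Real.exp (θ * u) := by
    rw [← Real.exp_add]
    refine Real.exp_le_exp.2 ?_
    have := mul_le_mul_of_nonneg_left (h.total_le y u hy hu) hκ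
    have := mul_le_mul_of_nonneg_right hκθ hu.le
    nlinarith
  rw [norm_mul, Real.norm_of_nonneg hw0, Real.norm_eq_abs]
  calc w u * |f (T y u) - f y|
      ≤ w u * (K * (u * (1 + totalEnergy y))
        * (Real.exp (2 * κ * totalEnergy y) * Real.exp (θ * u))) := by
        refine mul_le_mul_of_nonneg_left (h1.trans ?_) hw0
        gcongr
    _ = _ := by ring

theorem aestronglyMeasurable (h : IsJumpChannel θ w T) (hfm : Measurable f) {μ : Measure ℝ} :
    AEStronglyMeasurable (fun u => w u * (f (T y u) - f y)) μ := by
  have hT : Measurable (fun u => T y u) := h.measurable_jump.comp (measurable_const.prodMk measurable_id)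
  exact (h.measurable_weight.mul ((hfm.comp hT).sub_const _)).aestronglyMeasurable

theorem abs_jumpOperator_le (h : IsJumpChannel θ w T) (hκ : 0 ≤ κ) (hκθ : κ ≤ θ) (hK : 0 ≤ K)
    (hf : ExpLipschitz K κ f) (hy : 0 ≤ y) :
    |jumpOperator w T f y|
      ≤ K * (1 + totalEnergy y) * Real.exp (2 * κ * totalEnergy y) * jumpMoment θ w := by
  rw [jumpMoment, ← integral_const_mul, ← Real.norm_eq_abs]
  exact norm_integral_le_of_norm_le (h.integrable.const_mul _)
    ((ae_restrict_iff' measurableSet_Ioi).2 (Eventually.of_forall fun _ hu =>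
      h.integrand_le hκ hκθ hK hf hy hu))

theorem tendsto_jumpOperator (h : IsJumpChannel θ w T) (hκ : 0 ≤ κ) (hκθ : κ ≤ θ) (hK : 0 ≤ K)
    {F : ℕ → (ι → ℝ) → ℝ} (hFm : ∀ k, Measurable (F k)) (hF : ∀ k, ExpLipschitz K κ (F k))
    (hlim : ∀ y, 0 ≤ y → Tendsto (fun k => F k y) atTop (𝓝 (f y))) (hy : 0 ≤ y) :
    Tendsto (fun k => jumpOperator w T (F k) y) atTop (𝓝 (jumpOperator w T f y)) := by
  refine tendsto_integral_of_dominated_convergence _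
    (fun k => h.aestronglyMeasurable (hFm k)) (h.integrable.const_mul _)
    (fun k => (ae_restrict_iff' measurableSet_Ioi).2 (Eventually.of_forall fun _ hu =>
      h.integrand_le hκ hκθ hK (hF k) hy hu))
    ((ae_restrict_iff' measurableSet_Ioi).2 (Eventually.of_forall fun u hu => ?_))
  by_cases hw : w u = 0
  · simp [hw]
  · exact ((hlim _ (h.jump_nonneg y u hy hu hw)).sub (hlim y hy)).const_mul _

theorem measurable_jumpOperator (h : IsJumpChannel θ w T) (hfm : Measurable f) :
    Measurable (jumpOperator w T f) := by
  have : Measurable (fun p : (ι → ℝ) × ℝ => w p.2 * (f (T p.1 p.2) - f p.1)) :=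
    (h.measurable_weight.comp measurable_snd).mul
      ((hfm.comp h.measurable_jump).sub (hfm.comp measurable_fst))
  exact (this.stronglyMeasurable.integral_prod_right'
    (ν := volume.restrict (Set.Ioi (0 : ℝ)))).measurable

/-- Jumps of nonzero rate stay in the orthant, so a compactly supported test function may stand for
any function that agrees with it there. -/
theorem jumpOperator_congr (h : IsJumpChannel θ w T) (hfg : ∀ y, 0 ≤ y → f y = g y) (hy : 0 ≤ y) :
    jumpOperator w T f y = jumpOperator w T g y := by
  refine setIntegral_congr_fun measurableSet_Ioi fun u hu => ?_
  by_cases hw : w u = 0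
  · simp [hw]
  · simp only [hfg y hy, hfg _ (h.jump_nonneg y u hy hu hw)]

/-- The image of a Lipschitz function of bounded support is bounded on the orthant. -/
theorem exists_abs_jumpOperator_le (h : IsJumpChannel θ w T) (hκ : 0 ≤ κ) (hκθ : κ ≤ θ) (hK : 0 ≤ K)
    (hf : ExpLipschitz K κ f) {R B : ℝ} (hR : 0 ≤ R)
    (hsupp : ∀ y, 0 ≤ y → R ≤ totalEnergy y → f y = 0) (hB : ∀ y, 0 ≤ y → |f y| ≤ B) :
    ∃ C, ∀ y, 0 ≤ y → |jumpOperator w T f y| ≤ C := by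
  have hM := h.moment_nonneg
  have hθ : 0 ≤ θ := hκ.trans hκθ
  have hB0 : 0 ≤ B := (abs_nonneg _).trans (hB 0 le_rfl)
  refine ⟨max (K * (1 + 2 * R) * Real.exp (2 * κ * (2 * R)) * jumpMoment θ w)
    (2 * B * jumpMoment θ w), fun y hy => ?_⟩
  have hS := totalEnergy_nonneg hy
  -- Up to energy `2 * R` the Lipschitz bound suffices. Beyond it `f y = 0`, and a jump with `u < 1
  -- / 2` keeps at least half of the energy, hence misses the support; for `u ≥ 1 / 2` the bound `1
  -- ≤ 2 * u * exp (θ * u)` makes the remaining rates integrable.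
  rcases le_total (totalEnergy y) (2 * R) with hyR | hyR
  · refine (h.abs_jumpOperator_le hκ hκθ hK hf hy).trans (le_max_of_le_left ?_)
    gcongr
  · refine le_max_of_le_right ?_
    rw [jumpMoment, ← integral_const_mul, ← Real.norm_eq_abs]
    refine norm_integral_le_of_norm_le (h.integrable.const_mul _)
      ((ae_restrict_iff' measurableSet_Ioi).2 (Eventually.of_forall fun u hu => ?_))
    have hu : 0 < u := hu
    by_cases hw : w u = 0
    · simp [hw]
    have hw0 := h.weight_nonneg u hu
    rw [hsupp y hy (by linarith), sub_zero, norm_mul, Real.norm_of_nonneg hw0, Real.norm_eq_abs]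
    have hTn := h.jump_nonneg y u hy hu hw
    rcases lt_or_ge u (1 / 2) with hu2 | hu2
    · have := h.total_ge y u hy hu
      rw [hsupp _ hTn (by nlinarith)]
      simp only [abs_zero, mul_zero]
      positivity
    · have h1 : 1 ≤ 2 * (u * Real.exp (θ * u)) := by
        have := Real.one_le_exp (mul_nonneg hθ hu.le)
        nlinarith
      calc w u * |f (T y u)| ≤ w u * (B * (2 * (u * Real.exp (θ * u)))) := by
            refine mul_le_mul_of_nonneg_left ((hB _ hTn).trans ?_) hw0
            exact le_mul_of_one_le_right hB0 h1
        _ = _ := by ring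

/-- Nondecreasing functions of the total energy with logarithmic slope at most `θ` are Lyapunov
functions. -/
theorem jumpOperator_totalEnergy_le (h : IsJumpChannel θ w T) (hθ : 0 ≤ θ) {G : ℝ → ℝ}
    (hG0 : ∀ a, 0 ≤ G a) (hGm : Monotone G)
    (hG : ∀ a u, 0 ≤ u → G (a + u) ≤ Real.exp (θ * u) * G a) (hy : 0 ≤ y) :
    jumpOperator w T (fun z => G (totalEnergy z)) y
      ≤ θ * jumpMoment θ w * G (totalEnergy y) := by
  have hM := h.moment_nonneg
  unfold jumpOperator
  -- If the integrand is not integrable, the integral is `0` by convention and the nonnegative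
  -- right-hand side bounds it.
  by_cases hint : IntegrableOn
      (fun u => w u * (G (totalEnergy (T y u)) - G (totalEnergy y))) (Set.Ioi 0)
  · have : θ * jumpMoment θ w * G (totalEnergy y)
        = ∫ u in Set.Ioi (0 : ℝ), θ * G (totalEnergy y) * (w u * (u * Real.exp (θ * u))) := by
      rw [integral_const_mul, jumpMoment]; ring
    rw [this]
    refine setIntegral_mono_on hint (h.integrable.const_mul _) measurableSet_Ioi fun u hu => ?_
    have hu : 0 < u := hu
    have hw0 := h.weight_nonneg u hu
    have h1 : G (totalEnergy (T y u)) ≤ Real.exp (θ * u) * G (totalEnergy y) :=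
      (hGm (h.total_le y u hy hu)).trans (hG _ _ hu.le)
    have h2 : Real.exp (θ * u) - 1 ≤ θ * u * Real.exp (θ * u) := by
      have h3 := Real.add_one_le_exp (-(θ * u))
      have h4 : Real.exp (-(θ * u)) * Real.exp (θ * u) = 1 := by
        rw [← Real.exp_add]; simp
      nlinarith [Real.exp_pos (θ * u)]
    calc w u * (G (totalEnergy (T y u)) - G (totalEnergy y))
        ≤ w u * (θ * u * Real.exp (θ * u) * G (totalEnergy y)) := by
          refine mul_le_mul_of_nonneg_left ?_ hw0
          nlinarith [hG0 (totalEnergy y)]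
      _ = _ := by ring
  · rw [integral_undef hint]
    have := hG0 (totalEnergy y)
    positivity

end IsJumpChannel

end JumpChannel

/-! ### A smooth truncation of the energy -/

section SmoothTruncation

/-- A smooth nondecreasing function which is the identity on `[0, R]` and constant from `R + 1`
on. -/
noncomputable def smoothTruncation (R u : ℝ) : ℝ :=
  ∫ v in (0 : ℝ)..u, (1 - Real.smoothTransition (v - R))

theorem continuous_one_sub_smoothTransition (R : ℝ) :
    Continuous (fun v => 1 - Real.smoothTransition (v - R)) :=
  continuous_const.sub (Real.smoothTransition.continuous.comp (continuous_id.sub continuous_const))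

theorem hasDerivAt_smoothTruncation (R u : ℝ) :
    HasDerivAt (smoothTruncation R) (1 - Real.smoothTransition (u - R)) u :=
  intervalIntegral.integral_hasDerivAt_right
    ((continuous_one_sub_smoothTransition R).intervalIntegrable _ _)
    ((continuous_one_sub_smoothTransition R).stronglyMeasurableAtFilter _ _)
    (continuous_one_sub_smoothTransition R).continuousAt

theorem contDiff_smoothTruncation (R : ℝ) : ContDiff ℝ (⊤ : ℕ∞) (smoothTruncation R) := by
  have hd : deriv (smoothTruncation R) = fun u => 1 - Real.smoothTransition (u - R) :=
    funext fun u => (hasDerivAt_smoothTruncation R u).deriv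
  refine contDiff_infty_iff_deriv.2
    ⟨fun u => (hasDerivAt_smoothTruncation R u).differentiableAt, ?_⟩
  rw [hd]
  exact contDiff_const.sub (Real.smoothTransition.contDiff.comp (contDiff_id.sub contDiff_const))

theorem smoothTruncation_sub (R a b : ℝ) :
    smoothTruncation R b - smoothTruncation R a
      = ∫ v in a..b, (1 - Real.smoothTransition (v - R)) :=
  intervalIntegral.integral_interval_sub_left
    ((continuous_one_sub_smoothTransition R).intervalIntegrable _ _)
    ((continuous_one_sub_smoothTransition R).intervalIntegrable _ _)

theorem monotone_smoothTruncation (R : ℝ) : Monotone (smoothTruncation R) := by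
  intro a b hab
  rw [← sub_nonneg, smoothTruncation_sub]
  exact intervalIntegral.integral_nonneg hab fun v _ =>
    sub_nonneg.2 (Real.smoothTransition.le_one _)

/-- The slope is at most `1`, so the exponential of `θ` times the truncation satisfies the growth
condition of `jumpOperator_totalEnergy_le` for every `R`. -/
theorem smoothTruncation_add_le (R a : ℝ) {u : ℝ} (hu : 0 ≤ u) :
    smoothTruncation R (a + u) ≤ smoothTruncation R a + u := by
  rw [← sub_le_iff_le_add', smoothTruncation_sub]
  calc ∫ v in a..a + u, (1 - Real.smoothTransition (v - R)) ≤ ∫ v in a..a + u, (1 : ℝ) :=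
        intervalIntegral.integral_mono_on (by linarith)
          ((continuous_one_sub_smoothTransition R).intervalIntegrable _ _)
          (continuous_const.intervalIntegrable _ _)
          fun v _ => by linarith [Real.smoothTransition.nonneg (v - R)]
    _ = u := by simp

theorem smoothTruncation_of_le {R u : ℝ} (h0 : 0 ≤ u) (hu : u ≤ R) : smoothTruncation R u = u := by
  have : smoothTruncation R u = ∫ v in (0 : ℝ)..u, (1 : ℝ) := by
    refine intervalIntegral.integral_congr fun v hv => ?_
    rw [Set.uIcc_of_le h0] at hv
    rw [Real.smoothTransition.zero_of_nonpos (by linarith [hv.2]), sub_zero]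
  simpa using this

theorem smoothTruncation_of_ge {R u : ℝ} (hu : R + 1 ≤ u) :
    smoothTruncation R u = smoothTruncation R (R + 1) := by
  rw [← sub_eq_zero, smoothTruncation_sub]
  have : ∫ v in (R + 1)..u, (1 - Real.smoothTransition (v - R)) = ∫ v in (R + 1)..u, (0 : ℝ) := by
    refine intervalIntegral.integral_congr fun v hv => ?_
    rw [Set.uIcc_of_le hu] at hv
    rw [Real.smoothTransition.one_of_one_le (by linarith [hv.1]), sub_self]
  simpa using this

end SmoothTruncation

/-! ### Exponential moments of the jump process -/

section JumpProcess

variable {ι 𝒞 : Type*} [Fintype ι] [Fintype 𝒞]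

/-- The sum of finitely many jump operators. -/
noncomputable def jumpSum (w : 𝒞 → ℝ → ℝ) (T : 𝒞 → (ι → ℝ) → ℝ → ι → ℝ) (f : (ι → ℝ) → ℝ) (y : ι → ℝ) : ℝ :=
  ∑ c, jumpOperator (w c) (T c) f y

variable {w : 𝒞 → ℝ → ℝ} {T : 𝒞 → (ι → ℝ) → ℝ → ι → ℝ} {θ κ K : ℝ}

theorem measurable_jumpSum (hch : ∀ c, IsJumpChannel θ (w c) (T c)) {f : (ι → ℝ) → ℝ}
    (hf : Measurable f) : Measurable (jumpSum w T f) :=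
  Finset.measurable_fun_sum _ fun c _ => (hch c).measurable_jumpOperator hf

theorem expLipschitz_of_hasCompactSupport {f : (ι → ℝ) → ℝ} (hf : ContDiff ℝ (⊤ : ℕ∞) f)
    (hc : HasCompactSupport f) : ∃ K, 0 ≤ K ∧ ExpLipschitz K 0 f := by
  obtain ⟨K, hK⟩ := hf.lipschitzWith_of_hasCompactSupport hc (by simp)
  refine ⟨K, K.2, fun a b _ _ => ?_⟩
  have := hK.dist_le_mul a b
  rw [Real.dist_eq, dist_eq_norm] at this
  simpa using this

theorem exists_abs_jumpSum_le (hch : ∀ c, IsJumpChannel θ (w c) (T c)) (hθ : 0 ≤ θ)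
    {f : (ι → ℝ) → ℝ} (hf : ContDiff ℝ (⊤ : ℕ∞) f) (hc : HasCompactSupport f) :
    ∃ C, ∀ y, 0 ≤ y → |jumpSum w T f y| ≤ C := by
  obtain ⟨K, hK, hL⟩ := expLipschitz_of_hasCompactSupport hf hc
  obtain ⟨B, hB⟩ := hc.exists_bound_of_continuous hf.continuous
  obtain ⟨r, hr⟩ := hc.isCompact.isBounded.subset_closedBall (0 : ι → ℝ)
  -- A nonnegative point of the sup-norm ball of radius `r` has energy at most `card ι * |r|`; the
  -- `+ 1` makes the comparison strict.
  have hsupp : ∀ y : ι → ℝ, 0 ≤ y → Fintype.card ι * |r| + 1 ≤ totalEnergy y → f y = 0 := by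
    intro y hy hyR
    by_contra hne
    have h1 : ‖y‖ ≤ r := by simpa using hr (subset_tsupport f hne)
    have h2 : totalEnergy y ≤ ∑ _i : ι, |r| := Finset.sum_le_sum fun i _ =>
      (le_abs_self _).trans ((norm_le_pi_norm y i).trans (h1.trans (le_abs_self r)))
    rw [Finset.sum_const, Finset.card_univ, nsmul_eq_mul] at h2
    linarith
  choose C hC using fun c => (hch c).exists_abs_jumpOperator_le le_rfl hθ hK hL
    (R := Fintype.card ι * |r| + 1) (by positivity) hsupp (B := B) (fun y _ => hB y)
  exact ⟨∑ c, C c, fun y hy => (Finset.abs_sum_le_sum_abs _ _).trans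
    (Finset.sum_le_sum fun c _ => hC c y hy)⟩

variable {Ω : Type*} {mΩ : MeasurableSpace Ω} {P : Measure Ω}
  [IsProbabilityMeasure P] {ℱ : Filtration ℝ≥0 mΩ} {Y : ℝ≥0 → Ω → ι → ℝ}
  {A : ((ι → ℝ) → ℝ) → (ι → ℝ) → ℝ} {y : ι → ℝ}

theorem dynkin_of_hasCompactSupport (hch : ∀ c, IsJumpChannel θ (w c) (T c)) (hθ : 0 ≤ θ)
    (hA : ∀ f z, (∀ i, 0 < z i) → A f z = jumpSum w T f z) (hpos : ∀ t ω i, 0 < Y t ω i)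
    (hY : IsMartingaleSolution P ℱ Y {f | ContDiff ℝ (⊤ : ℕ∞) f ∧ HasCompactSupport f} A y)
    {f : (ι → ℝ) → ℝ} (hf : ContDiff ℝ (⊤ : ℕ∞) f) (hc : HasCompactSupport f) (t : ℝ≥0) :
    Integrable (fun ω => f (Y t ω)) P ∧
      ∫ ω, f (Y t ω) ∂P = f y + ∫ r in (0 : ℝ)..t, ∫ ω, jumpSum w T f (Y r.toNNReal ω) ∂P := by
  obtain ⟨C, hC⟩ := exists_abs_jumpSum_le hch hθ hf hc
  exact hY.integral_eq ⟨hf, hc⟩ (measurable_jumpSum hch hf.continuous.measurable)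
    (fun r ω => hA f _ (hpos r ω)) (fun r ω => hC _ fun i => (hpos r ω i).le) t

omit [Fintype ι] in
theorem jumpSum_const_sub (c : ℝ) (G : (ι → ℝ) → ℝ) (z : ι → ℝ) :
    jumpSum w T (fun z => c - G z) z = - jumpSum w T G z := by
  simp only [jumpSum, jumpOperator, ← Finset.sum_neg_distrib, ← integral_neg]
  refine Finset.sum_congr rfl fun c _ => ?_
  congr 1; ext u; ring

/-- The truncated exponential `G` is constant at high energy, so the top value minus `G` agrees on
the orthant with a genuine test function. Its Dynkin formula, the Lyapunov inequality for `G` and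
Grönwall give a bound that does not depend on `R`. -/
theorem integral_exp_smoothTruncation_le (hch : ∀ c, IsJumpChannel θ (w c) (T c)) (hθ : 0 ≤ θ)
    (hA : ∀ f z, (∀ i, 0 < z i) → A f z = jumpSum w T f z) (hpos : ∀ t ω i, 0 < Y t ω i)
    (hY : IsMartingaleSolution P ℱ Y {f | ContDiff ℝ (⊤ : ℕ∞) f ∧ HasCompactSupport f} A y)
    (hy : 0 ≤ y) {R : ℝ} (hR : 0 ≤ R) (t : ℝ≥0) :
    Integrable (fun ω => Real.exp (θ * smoothTruncation R (totalEnergy (Y t ω)))) P ∧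
      ∫ ω, Real.exp (θ * smoothTruncation R (totalEnergy (Y t ω))) ∂P
        ≤ Real.exp (θ * totalEnergy y) * Real.exp ((∑ c, θ * jumpMoment θ (w c)) * t) := by
  set G : ℝ → ℝ := fun u => Real.exp (θ * smoothTruncation R u) with hGdef
  have hGs : ContDiff ℝ (⊤ : ℕ∞) G := Real.contDiff_exp.comp
    (contDiff_const.mul (contDiff_smoothTruncation R))
  have hG0 : ∀ a, 0 ≤ G a := fun a => (Real.exp_pos _).le
  have hGm : Monotone G := fun a b hab =>
    Real.exp_le_exp.2 (mul_le_mul_of_nonneg_left (monotone_smoothTruncation R hab) hθ)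
  have hGadd : ∀ a u, 0 ≤ u → G (a + u) ≤ Real.exp (θ * u) * G a := by
    intro a u hu
    rw [hGdef, ← Real.exp_add]
    refine Real.exp_le_exp.2 ?_
    have := mul_le_mul_of_nonneg_left (smoothTruncation_add_le R a hu) hθ
    linarith
  have hGtop : ∀ a, G a ≤ G (R + 1) := by
    intro a
    rcases le_total a (R + 1) with ha | ha
    · exact hGm ha
    · rw [hGdef]; simp only [smoothTruncation_of_ge ha]; exact le_rfl
  have hGcont : Continuous G := hGs.continuous
  set C : ℝ := ∑ c, θ * jumpMoment θ (w c) with hCdef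
  have hC0 : 0 ≤ C := Finset.sum_nonneg fun c _ => mul_nonneg hθ (hch c).moment_nonneg
  have hLyap : ∀ z : ι → ℝ, 0 ≤ z →
      jumpSum w T (fun z => G (totalEnergy z)) z ≤ C * G (totalEnergy z) := by
    intro z hz
    rw [hCdef, Finset.sum_mul]
    exact Finset.sum_le_sum fun c _ => (hch c).jumpOperator_totalEnergy_le hθ hG0 hGm hGadd hz
  -- The energy can stay small on an unbounded set outside the orthant, hence the bump. On the
  -- orthant it changes nothing: it is `1` where the energy is at most `R + 1`, and beyond that the
  -- other factor vanishes.
  let χ : ContDiffBump (0 : ι → ℝ) := ⟨R + 1, R + 2, by linarith, by linarith⟩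
  set f : (ι → ℝ) → ℝ := fun z => (G (R + 1) - G (totalEnergy z)) * χ z with hfdef
  have hfs : ContDiff ℝ (⊤ : ℕ∞) f :=
    (contDiff_const.sub (hGs.comp contDiff_totalEnergy)).mul χ.contDiff
  have hfc : HasCompactSupport f := χ.hasCompactSupport.mul_left
  have hfeq : ∀ z : ι → ℝ, 0 ≤ z → f z = G (R + 1) - G (totalEnergy z) := by
    intro z hz
    rcases le_total (totalEnergy z) (R + 1) with hzR | hzR
    · have : χ z = 1 := χ.one_of_mem_closedBall (by
        rw [mem_closedBall_zero_iff]; exact (norm_le_totalEnergy hz).trans hzR)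
      rw [hfdef]; simp only [this, mul_one]
    · have : G (totalEnergy z) = G (R + 1) := by
        simp only [hGdef, smoothTruncation_of_ge hzR]
      rw [hfdef]; simp only [this, sub_self, zero_mul]
  have hfjump : ∀ z : ι → ℝ, 0 ≤ z →
      jumpSum w T f z = - jumpSum w T (fun z => G (totalEnergy z)) z := by
    intro z hz
    rw [← jumpSum_const_sub (G (R + 1))]
    exact Finset.sum_congr rfl fun c _ => (hch c).jumpOperator_congr hfeq hz
  have hYn : ∀ t ω, 0 ≤ Y t ω := fun t ω i => (hpos t ω i).le
  have hGint : ∀ t, Integrable (fun ω => G (totalEnergy (Y t ω))) P := fun t =>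
    Integrable.of_bound ((hGcont.comp continuous_totalEnergy).measurable.comp
      (hY.measurable t)).aestronglyMeasurable (G (R + 1))
      (Eventually.of_forall fun ω => by
        rw [Real.norm_of_nonneg (hG0 _)]; exact hGtop _)
  refine ⟨hGint t, ?_⟩
  set m : ℝ → ℝ := fun r => ∫ ω, G (totalEnergy (Y r.toNNReal ω)) ∂P with hm
  obtain ⟨B, hB⟩ := exists_abs_jumpSum_le hch hθ hfs hfc
  have hjm := measurable_jumpSum hch (w := w) (T := T) hfs.continuous.measurable
  have hjint : ∀ t, Integrable (fun ω => jumpSum w T f (Y t ω)) P := fun t =>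
    Integrable.of_bound (hjm.comp (hY.measurable t)).aestronglyMeasurable B
      (Eventually.of_forall fun ω => hB _ (hYn t ω))
  have hJb : ∀ r : ℝ, ‖∫ ω, jumpSum w T f (Y r.toNNReal ω) ∂P‖ ≤ B := fun r =>
    (norm_integral_le_of_norm_le_const (Eventually.of_forall fun ω => hB _ (hYn _ ω))).trans
      (by simp)
  have hJint : ∀ s : Set ℝ, volume s < ⊤ →
      IntegrableOn (fun r : ℝ => ∫ ω, jumpSum w T f (Y r.toNNReal ω) ∂P) s := fun s hs =>
    IntegrableOn.of_bound hs (hY.measurable_integral hjm).aestronglyMeasurable B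
      (Eventually.of_forall fun r => hJb r)
  have heq : ∀ r ∈ Set.Icc (0 : ℝ) t, m r = G (totalEnergy y)
      + ∫ r in (0 : ℝ)..r, -∫ ω, jumpSum w T f (Y r.toNNReal ω) ∂P := by
    intro r hr
    have h1 := (dynkin_of_hasCompactSupport hch hθ hA hpos hY hfs hfc r.toNNReal).2
    rw [hfeq y hy, Real.coe_toNNReal r hr.1,
      integral_congr_ae (Eventually.of_forall fun ω => hfeq _ (hYn _ ω)),
      integral_sub (integrable_const _) (hGint _)] at h1
    simp only [integral_const, probReal_univ, one_smul] at h1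
    rw [intervalIntegral.integral_neg, hm]
    simp only
    linarith
  have hmc : ContinuousOn m (Set.Icc 0 t) :=
    continuousOn_of_eq_add_integral t.coe_nonneg (hJint _ (by simp)).neg heq
  have hle : ∀ r ∈ Set.Icc (0 : ℝ) t, m r ≤ G (totalEnergy y) + C * ∫ r in (0 : ℝ)..r, m r := by
    intro r hr
    rw [heq r hr, ← intervalIntegral.integral_const_mul]
    gcongr
    refine intervalIntegral.integral_mono_on hr.1 ?_ ?_ fun x hx => ?_
    · exact ((intervalIntegrable_iff_integrableOn_Ioc_of_le hr.1).2 (hJint _ (by simp))).neg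
    · exact ((hmc.mono (Set.Icc_subset_Icc_right hr.2)).intervalIntegrable_of_Icc hr.1).const_mul C
    · rw [← integral_neg, hm, ← integral_const_mul]
      refine integral_mono (hjint _).neg ((hGint _).const_mul C) fun ω => ?_
      simp only [hfjump _ (hYn _ ω), neg_neg]
      exact hLyap _ (hYn _ ω)
  have hfin := le_mul_exp_of_le_add_integral t.coe_nonneg hC0 hmc hle
  simp only [hm, Real.toNNReal_coe] at hfin
  refine hfin.trans (mul_le_mul_of_nonneg_right ?_ (Real.exp_pos _).le)
  have h0 := smoothTruncation_add_le R 0 (totalEnergy_nonneg hy)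
  rw [smoothTruncation_of_le le_rfl hR, zero_add] at h0
  exact Real.exp_le_exp.2 (mul_le_mul_of_nonneg_left h0 hθ)

/-- Exponential moments of the total energy. -/
theorem integral_exp_totalEnergy_le (hch : ∀ c, IsJumpChannel θ (w c) (T c)) (hθ : 0 ≤ θ)
    (hA : ∀ f z, (∀ i, 0 < z i) → A f z = jumpSum w T f z) (hpos : ∀ t ω i, 0 < Y t ω i)
    (hY : IsMartingaleSolution P ℱ Y {f | ContDiff ℝ (⊤ : ℕ∞) f ∧ HasCompactSupport f} A y)
    (hy : 0 ≤ y) (t : ℝ≥0) :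
    Integrable (fun ω => Real.exp (θ * totalEnergy (Y t ω))) P ∧
      ∫ ω, Real.exp (θ * totalEnergy (Y t ω)) ∂P
        ≤ Real.exp (θ * totalEnergy y) * Real.exp ((∑ c, θ * jumpMoment θ (w c)) * t) := by
  set B := Real.exp (θ * totalEnergy y) * Real.exp ((∑ c, θ * jumpMoment θ (w c)) * t) with hB
  have hB0 : 0 ≤ B := by positivity
  have hmeas : Measurable (fun ω => Real.exp (θ * totalEnergy (Y t ω))) :=
    (Continuous.measurable (by fun_prop :
      Continuous (fun z : ι → ℝ => Real.exp (θ * totalEnergy z)))).comp (hY.measurable t)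
  -- Fatou's lemma: at each `ω` the truncations eventually equal the energy, and their moments share
  -- the bound `B`.
  have hfin : ∫⁻ ω, ENNReal.ofReal (Real.exp (θ * totalEnergy (Y t ω))) ∂P ≤ ENNReal.ofReal B := by
    have hk := fun k : ℕ => integral_exp_smoothTruncation_le hch hθ hA hpos hY hy
      (Nat.cast_nonneg k) t
    calc ∫⁻ ω, ENNReal.ofReal (Real.exp (θ * totalEnergy (Y t ω))) ∂P
        = ∫⁻ ω, liminf (fun k : ℕ => ENNReal.ofReal
            (Real.exp (θ * smoothTruncation k (totalEnergy (Y t ω))))) atTop ∂P := by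
          refine lintegral_congr fun ω => (Tendsto.liminf_eq ?_).symm
          refine tendsto_const_nhds.congr' ?_
          filter_upwards [eventually_ge_atTop ⌈totalEnergy (Y t ω)⌉₊] with k hk
          rw [smoothTruncation_of_le (totalEnergy_nonneg fun i => (hpos t ω i).le)
            (Nat.ceil_le.1 hk)]
      _ ≤ liminf (fun k : ℕ => ∫⁻ ω, ENNReal.ofReal
            (Real.exp (θ * smoothTruncation k (totalEnergy (Y t ω)))) ∂P) atTop :=
          lintegral_liminf_le' fun k => (hk k).1.aemeasurable.ennreal_ofReal
      _ ≤ ENNReal.ofReal B := by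
          refine liminf_le_of_le (by isBoundedDefault) fun b hb => ?_
          obtain ⟨k, hkb⟩ := hb.exists
          refine hkb.trans ?_
          rw [← ofReal_integral_eq_lintegral_ofReal (hk k).1
            (Eventually.of_forall fun ω => (Real.exp_pos _).le)]
          exact ENNReal.ofReal_le_ofReal (hk k).2
  have hint : Integrable (fun ω => Real.exp (θ * totalEnergy (Y t ω))) P :=
    ⟨hmeas.aestronglyMeasurable, by
      rw [hasFiniteIntegral_iff_ofReal (Eventually.of_forall fun ω => (Real.exp_pos _).le)]
      exact hfin.trans_lt ENNReal.ofReal_lt_top⟩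
  refine ⟨hint, ?_⟩
  rw [← ofReal_integral_eq_lintegral_ofReal hint
    (Eventually.of_forall fun ω => (Real.exp_pos _).le)] at hfin
  exact (ENNReal.ofReal_le_ofReal_iff hB0).1 hfin

end JumpProcess

/-! ### Polynomial growth -/

section PolyLipschitz

variable {ι : Type*} [Fintype ι]

/-- Functions on the orthant which, like their local Lipschitz constants, grow polynomially. -/
def PolyLipschitz (f : (ι → ℝ) → ℝ) : Prop :=
  ∃ (K : ℝ) (p : ℕ), 0 ≤ K ∧ ∀ a b, 0 ≤ a → 0 ≤ b → |f a| ≤ K * (1 + totalEnergy a) ^ p ∧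
    |f a - f b| ≤ K * ‖a - b‖ * (1 + (totalEnergy a + totalEnergy b)) ^ p

theorem polyLipschitz_const (c : ℝ) : PolyLipschitz (fun _ : ι → ℝ => c) :=
  ⟨|c|, 0, abs_nonneg c, fun a b _ _ => by simp; positivity⟩

theorem polyLipschitz_apply (i : ι) : PolyLipschitz (fun y : ι → ℝ => y i) := by
  refine ⟨1, 1, zero_le_one, fun a b ha hb => ⟨?_, ?_⟩⟩
  · rw [abs_of_nonneg (ha i)]
    have := le_totalEnergy ha i
    linarith
  · have h1 := norm_le_pi_norm (a - b) i
    rw [Pi.sub_apply, Real.norm_eq_abs] at h1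
    have h2 := totalEnergy_nonneg ha
    have h3 := totalEnergy_nonneg hb
    rw [one_mul, pow_one]
    exact h1.trans (le_mul_of_one_le_right (norm_nonneg _) (by linarith))

theorem PolyLipschitz.mul {f g : (ι → ℝ) → ℝ} (hf : PolyLipschitz f) (hg : PolyLipschitz g) :
    PolyLipschitz (fun y => f y * g y) := by
  obtain ⟨K, p, hK, hf⟩ := hf
  obtain ⟨L, q, hL, hg⟩ := hg
  refine ⟨2 * (K * L), p + q, by positivity, fun a b ha hb => ?_⟩
  have hSa := totalEnergy_nonneg ha
  have hSb := totalEnergy_nonneg hb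
  constructor
  · rw [abs_mul, pow_add]
    calc |f a| * |g a| ≤ (K * (1 + totalEnergy a) ^ p) * (L * (1 + totalEnergy a) ^ q) :=
          mul_le_mul (hf a b ha hb).1 (hg a b ha hb).1 (abs_nonneg _) (by positivity)
      _ = (K * L) * ((1 + totalEnergy a) ^ p * (1 + totalEnergy a) ^ q) := by ring
      _ ≤ 2 * (K * L) * ((1 + totalEnergy a) ^ p * (1 + totalEnergy a) ^ q) := by
          gcongr ?_ * _
          linarith [mul_nonneg hK hL]
  · set s := 1 + (totalEnergy a + totalEnergy b) with hs
    have hs0 : 0 ≤ s := by linarith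
    have h1 : |f a| ≤ K * s ^ p := (hf a b ha hb).1.trans (by gcongr; linarith)
    have h2 : |g b| ≤ L * s ^ q := (hg b a hb ha).1.trans (by gcongr; linarith)
    calc |f a * g a - f b * g b| = |f a * (g a - g b) + (f a - f b) * g b| := by ring_nf
      _ ≤ |f a| * |g a - g b| + |f a - f b| * |g b| := by
          rw [← abs_mul, ← abs_mul]; exact abs_add_le _ _
      _ ≤ (K * s ^ p) * (L * ‖a - b‖ * s ^ q) + (K * ‖a - b‖ * s ^ p) * (L * s ^ q) :=
          add_le_add
            (mul_le_mul h1 (hg a b ha hb).2 (abs_nonneg _) (by positivity))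
            (mul_le_mul (hf a b ha hb).2 h2 (abs_nonneg _) (by positivity))
      _ = _ := by ring

theorem polyLipschitz_prod_pow (a : ι → ℕ) : PolyLipschitz (fun y : ι → ℝ => ∏ i, y i ^ a i) := by
  have hpow : ∀ (i : ι) (k : ℕ), PolyLipschitz (fun y : ι → ℝ => y i ^ k) := by
    intro i k
    induction k with
    | zero => simpa using polyLipschitz_const (ι := ι) 1
    | succ k ih => simpa only [pow_succ] using ih.mul (polyLipschitz_apply i)
  have : ∀ s : Finset ι, PolyLipschitz (fun y : ι → ℝ => ∏ i ∈ s, y i ^ a i) := by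
    classical
    intro s
    induction s using Finset.induction_on with
    | empty => simpa using polyLipschitz_const (ι := ι) 1
    | insert i s hi ih => simpa only [Finset.prod_insert hi] using (hpow i (a i)).mul ih
  exact this Finset.univ

end PolyLipschitz

theorem exists_one_add_pow_le_exp (p : ℕ) {κ : ℝ} (hκ : 0 < κ) :
    ∃ C, 0 ≤ C ∧ ∀ x, 0 ≤ x → (1 + x) ^ p ≤ C * Real.exp (κ * x) := by
  -- The constant is read off from `(κ * (1 + x)) ^ p / p! ≤ exp (κ * (1 + x))`.
  refine ⟨p.factorial / κ ^ p * Real.exp κ, by positivity, fun x hx => ?_⟩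
  have h := Real.pow_div_factorial_le_exp (κ * (1 + x)) (by positivity) p
  rw [mul_pow, mul_add, mul_one, Real.exp_add, div_le_iff₀ (by positivity)] at h
  rw [div_mul_eq_mul_div, div_mul_eq_mul_div, le_div_iff₀ (by positivity)]
  linarith

/-! ### Dynkin's formula beyond compact support -/

section JumpProcess

variable {ι 𝒞 : Type*} [Fintype ι] [Fintype 𝒞] {w : 𝒞 → ℝ → ℝ}
  {T : 𝒞 → (ι → ℝ) → ℝ → ι → ℝ} {θ κ K : ℝ} {Ω : Type*} {mΩ : MeasurableSpace Ω} {P : Measure Ω}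
  [IsProbabilityMeasure P] {ℱ : Filtration ℝ≥0 mΩ} {Y : ℝ≥0 → Ω → ι → ℝ}
  {A : ((ι → ℝ) → ℝ) → (ι → ℝ) → ℝ} {y : ι → ℝ}

/-- Dynkin's formula passes to limits of test functions with uniformly exponential Lipschitz
constants. -/
theorem dynkin_of_tendsto (hch : ∀ c, IsJumpChannel θ (w c) (T c))
    (hA : ∀ f z, (∀ i, 0 < z i) → A f z = jumpSum w T f z) (hpos : ∀ t ω i, 0 < Y t ω i)
    (hY : IsMartingaleSolution P ℱ Y {f | ContDiff ℝ (⊤ : ℕ∞) f ∧ HasCompactSupport f} A y)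
    (hy : 0 ≤ y) (hκ : 0 < κ) (hκθ : 3 * κ ≤ θ) (hK : 0 ≤ K)
    {F : ℕ → (ι → ℝ) → ℝ} {f : (ι → ℝ) → ℝ} (hFs : ∀ k, ContDiff ℝ (⊤ : ℕ∞) (F k))
    (hFc : ∀ k, HasCompactSupport (F k)) (hFL : ∀ k, ExpLipschitz K κ (F k))
    (hF0 : ∀ k, |F k 0| ≤ K) (hfm : Measurable f)
    (hlim : ∀ z, 0 ≤ z → Tendsto (fun k => F k z) atTop (𝓝 (f z))) (t : ℝ≥0) :
    Integrable (fun ω => f (Y t ω)) P ∧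
      IntegrableOn (fun r : ℝ => ∫ ω, f (Y r.toNNReal ω) ∂P) (Set.Icc 0 t) ∧
      ∫ ω, f (Y t ω) ∂P = f y + ∫ r in (0 : ℝ)..t, ∫ ω, jumpSum w T f (Y r.toNNReal ω) ∂P := by
  have hθ : 0 ≤ θ := by linarith
  have hYn : ∀ t ω, 0 ≤ Y t ω := fun t ω i => (hpos t ω i).le
  obtain ⟨C, hC, hCexp⟩ := exists_one_add_pow_le_exp 1 hκ
  simp only [pow_one] at hCexp
  set M : ℝ := ∑ c, jumpMoment θ (w c) with hM
  have hM0 : 0 ≤ M := Finset.sum_nonneg fun c _ => (hch c).moment_nonneg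
  -- This is where `3 * κ ≤ θ` is spent: one `κ` absorbs the factor `1 + totalEnergy z`, the other
  -- two are the exponent in the bound for the jump operator.
  have hpoly : ∀ z : ι → ℝ, 0 ≤ z → (1 + totalEnergy z) * Real.exp (2 * κ * totalEnergy z)
      ≤ C * Real.exp (θ * totalEnergy z) := by
    intro z hz
    have hS := totalEnergy_nonneg hz
    calc _ ≤ C * Real.exp (κ * totalEnergy z) * Real.exp (2 * κ * totalEnergy z) := by
          gcongr; exact hCexp _ hS
      _ = C * Real.exp (3 * κ * totalEnergy z) := by
          rw [mul_assoc, ← Real.exp_add]; ring_nf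
      _ ≤ _ := by gcongr
  have hFb : ∀ k z, 0 ≤ z → ‖F k z‖ ≤ K * C * Real.exp (θ * totalEnergy z) := by
    intro k z hz
    have hS := totalEnergy_nonneg hz
    have h1 := hFL k z 0 hz le_rfl
    have h0 : totalEnergy (0 : ι → ℝ) = 0 := by simp [totalEnergy]
    rw [sub_zero, h0, add_zero] at h1
    have h2 : |F k z| ≤ |F k z - F k 0| + |F k 0| := by
      simpa using abs_add_le (F k z - F k 0) (F k 0)
    have h3 : Real.exp (κ * totalEnergy z) ≤ Real.exp (2 * κ * totalEnergy z) :=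
      Real.exp_le_exp.2 (by nlinarith)
    have h4 : 1 ≤ Real.exp (2 * κ * totalEnergy z) := Real.one_le_exp (by positivity)
    calc |F k z| ≤ K * ‖z‖ * Real.exp (κ * totalEnergy z) + K := by linarith [hF0 k]
      _ ≤ K * totalEnergy z * Real.exp (2 * κ * totalEnergy z)
            + K * Real.exp (2 * κ * totalEnergy z) := by
          gcongr
          · exact norm_le_totalEnergy hz
          · exact le_mul_of_one_le_right hK h4
      _ = K * ((1 + totalEnergy z) * Real.exp (2 * κ * totalEnergy z)) := by ring
      _ ≤ K * (C * Real.exp (θ * totalEnergy z)) :=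
          mul_le_mul_of_nonneg_left (hpoly z hz) hK
      _ = _ := by ring
  have hJb : ∀ k z, 0 ≤ z → ‖jumpSum w T (F k) z‖ ≤ K * C * M * Real.exp (θ * totalEnergy z) := by
    intro k z hz
    calc |jumpSum w T (F k) z| ≤ ∑ c, |jumpOperator (w c) (T c) (F k) z| :=
          Finset.abs_sum_le_sum_abs _ _
      _ ≤ ∑ c, K * (1 + totalEnergy z) * Real.exp (2 * κ * totalEnergy z) * jumpMoment θ (w c) :=
          Finset.sum_le_sum fun c _ => (hch c).abs_jumpOperator_le hκ.le (by linarith) hK (hFL k) hz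
      _ = K * ((1 + totalEnergy z) * Real.exp (2 * κ * totalEnergy z)) * M := by
          rw [← Finset.mul_sum]; ring
      _ ≤ K * (C * Real.exp (θ * totalEnergy z)) * M :=
          mul_le_mul_of_nonneg_right (mul_le_mul_of_nonneg_left (hpoly z hz) hK) hM0
      _ = _ := by ring
  have hmom := integral_exp_totalEnergy_le hch hθ hA hpos hY hy
  set D : ℝ := ∑ c, θ * jumpMoment θ (w c) with hD
  have hD0 : 0 ≤ D := Finset.sum_nonneg fun c _ => mul_nonneg hθ (hch c).moment_nonneg
  set B : ℝ := Real.exp (θ * totalEnergy y) * Real.exp (D * t) with hB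
  have hmomB : ∀ r ∈ Set.Icc (0 : ℝ) t,
      ∫ ω, Real.exp (θ * totalEnergy (Y r.toNNReal ω)) ∂P ≤ B := by
    intro r hr
    refine (hmom r.toNNReal).2.trans ?_
    rw [Real.coe_toNNReal r hr.1, hB]
    gcongr
    exact hr.2
  have hFm : ∀ k, Measurable (F k) := fun k => (hFs k).continuous.measurable
  have hfb : ∀ z, 0 ≤ z → ‖f z‖ ≤ K * C * Real.exp (θ * totalEnergy z) := fun z hz =>
    le_of_tendsto (hlim z hz).norm (Eventually.of_forall fun k => hFb k z hz)
  have hfint : ∀ r : ℝ≥0, Integrable (fun ω => f (Y r ω)) P := fun r =>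
    ((hmom r).1.const_mul (K * C)).mono' (hfm.comp (hY.measurable r)).aestronglyMeasurable
      (Eventually.of_forall fun ω => hfb _ (hYn r ω))
  have hdyn := fun k => (dynkin_of_hasCompactSupport hch hθ hA hpos hY (hFs k) (hFc k) t).2
  have hlimJ : ∀ z, 0 ≤ z → Tendsto (fun k => jumpSum w T (F k) z) atTop (𝓝 (jumpSum w T f z)) :=
    fun z hz => tendsto_finsetSum _ fun c _ =>
      (hch c).tendsto_jumpOperator hκ.le (by linarith) hK hFm hFL hlim hz
  refine ⟨hfint t, ?_, ?_⟩
  · refine IntegrableOn.of_bound (by simp) (hY.measurable_integral hfm).aestronglyMeasurable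
      (K * C * B) ((ae_restrict_iff' measurableSet_Icc).2 (Eventually.of_forall fun r hr => ?_))
    calc ‖∫ ω, f (Y r.toNNReal ω) ∂P‖
        ≤ ∫ ω, K * C * Real.exp (θ * totalEnergy (Y r.toNNReal ω)) ∂P :=
          norm_integral_le_of_norm_le ((hmom _).1.const_mul _)
            (Eventually.of_forall fun ω => hfb _ (hYn _ ω))
      _ ≤ K * C * B := by
          rw [integral_const_mul]
          exact mul_le_mul_of_nonneg_left (hmomB r hr) (by positivity)
  · have h1 : Tendsto (fun k => ∫ ω, F k (Y t ω) ∂P) atTop (𝓝 (∫ ω, f (Y t ω) ∂P)) :=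
      tendsto_integral_of_dominated_convergence _
        (fun k => ((hFm k).comp (hY.measurable t)).aestronglyMeasurable)
        ((hmom t).1.const_mul (K * C))
        (fun k => Eventually.of_forall fun ω => hFb k _ (hYn t ω))
        (Eventually.of_forall fun ω => hlim _ (hYn t ω))
    have h2 : ∀ r : ℝ, Tendsto (fun k => ∫ ω, jumpSum w T (F k) (Y r.toNNReal ω) ∂P) atTop
        (𝓝 (∫ ω, jumpSum w T f (Y r.toNNReal ω) ∂P)) := fun r =>
      tendsto_integral_of_dominated_convergence _
        (fun k => ((measurable_jumpSum hch (hFm k)).comp (hY.measurable _)).aestronglyMeasurable)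
        ((hmom _).1.const_mul (K * C * M))
        (fun k => Eventually.of_forall fun ω => hJb k _ (hYn _ ω))
        (Eventually.of_forall fun ω => hlimJ _ (hYn _ ω))
    have h3 : Tendsto (fun k => ∫ r in (0 : ℝ)..t, ∫ ω, jumpSum w T (F k) (Y r.toNNReal ω) ∂P)
        atTop (𝓝 (∫ r in (0 : ℝ)..t, ∫ ω, jumpSum w T f (Y r.toNNReal ω) ∂P)) := by
      refine intervalIntegral.tendsto_integral_filter_of_dominated_convergence
        (fun _ => K * C * M * B)
        (Eventually.of_forall fun k =>
          (hY.measurable_integral (measurable_jumpSum hch (hFm k))).aestronglyMeasurable)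
        (Eventually.of_forall fun k => Eventually.of_forall fun r hr => ?_)
        intervalIntegrable_const (Eventually.of_forall fun r _ => h2 r)
      rw [Set.uIoc_of_le t.coe_nonneg] at hr
      calc ‖∫ ω, jumpSum w T (F k) (Y r.toNNReal ω) ∂P‖
          ≤ ∫ ω, K * C * M * Real.exp (θ * totalEnergy (Y r.toNNReal ω)) ∂P :=
            norm_integral_le_of_norm_le ((hmom _).1.const_mul _)
              (Eventually.of_forall fun ω => hJb k _ (hYn _ ω))
        _ ≤ K * C * M * B := by
            rw [integral_const_mul]
            exact mul_le_mul_of_nonneg_left (hmomB r ⟨hr.1.le, hr.2⟩) (by positivity)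
    have h4 := (hlim y hy).add h3
    simp only [← hdyn] at h4
    exact tendsto_nhds_unique h1 h4

/-- Dynkin's formula for functions of polynomial growth. -/
theorem dynkin_of_polyLipschitz (hch : ∀ c, IsJumpChannel θ (w c) (T c)) (hθ : 0 < θ)
    (hA : ∀ f z, (∀ i, 0 < z i) → A f z = jumpSum w T f z) (hpos : ∀ t ω i, 0 < Y t ω i)
    (hY : IsMartingaleSolution P ℱ Y {f | ContDiff ℝ (⊤ : ℕ∞) f ∧ HasCompactSupport f} A y)
    (hy : 0 ≤ y) {f : (ι → ℝ) → ℝ} (hfs : ContDiff ℝ (⊤ : ℕ∞) f) (hf : PolyLipschitz f) (t : ℝ≥0) :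
    Integrable (fun ω => f (Y t ω)) P ∧
      IntegrableOn (fun r : ℝ => ∫ ω, f (Y r.toNNReal ω) ∂P) (Set.Icc 0 t) ∧
      ∫ ω, f (Y t ω) ∂P = f y + ∫ r in (0 : ℝ)..t, ∫ ω, jumpSum w T f (Y r.toNNReal ω) ∂P := by
  have hκ : 0 < θ / 3 := by positivity
  obtain ⟨K, p, hK, hf⟩ := hf
  obtain ⟨C, hC, hCexp⟩ := exists_one_add_pow_le_exp p hκ
  -- Cutoffs `χ (c k • z)` with `c k ≤ 1` and `c k → 0`: their Lipschitz constants are all at most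
  -- `L`, and they tend pointwise to `χ 0 = 1`.
  let χ : ContDiffBump (0 : ι → ℝ) := ⟨1, 2, by norm_num, by norm_num⟩
  obtain ⟨L, hL⟩ := (χ.contDiff (n := (⊤ : ℕ∞))).lipschitzWith_of_hasCompactSupport
    χ.hasCompactSupport (by simp)
  let c : ℕ → ℝ := fun k => ((k : ℝ) + 1)⁻¹
  have hc0 : ∀ k, 0 < c k := fun k => by positivity
  have hc1 : ∀ k, c k ≤ 1 := fun k => inv_le_one_of_one_le₀ (by simp)
  let F : ℕ → (ι → ℝ) → ℝ := fun k z => f z * χ (c k • z)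
  have hFc : ∀ k, HasCompactSupport (F k) := fun k =>
    (χ.hasCompactSupport.comp_smul (hc0 k).ne').mul_left
  -- The product rule yields the first summand; the extra `K` serves only to bound the values at `0`
  -- by the same constant.
  have hFL : ∀ k, ExpLipschitz (K * (1 + L) * C + K) (θ / 3) (F k) := by
    intro k a b ha hb
    have hSa := totalEnergy_nonneg ha
    have hSb := totalEnergy_nonneg hb
    have h1 : |χ (c k • a) - χ (c k • b)| ≤ L * ‖a - b‖ := by
      have := hL.dist_le_mul (c k • a) (c k • b)
      rw [Real.dist_eq, dist_eq_norm, ← smul_sub, norm_smul, Real.norm_of_nonneg (hc0 k).le] at this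
      refine this.trans (mul_le_mul_of_nonneg_left ?_ L.2)
      exact mul_le_of_le_one_left (norm_nonneg _) (hc1 k)
    have h2 : |χ (c k • a)| ≤ 1 := by
      rw [abs_of_nonneg χ.nonneg]; exact χ.le_one
    have h3 : |f b| ≤ K * (1 + (totalEnergy a + totalEnergy b)) ^ p :=
      (hf b a hb ha).1.trans (by gcongr; linarith)
    calc |F k a - F k b|
        = |(f a - f b) * χ (c k • a) + f b * (χ (c k • a) - χ (c k • b))| := by
          simp only [F]; ring_nf
      _ ≤ |f a - f b| * |χ (c k • a)| + |f b| * |χ (c k • a) - χ (c k • b)| := by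
          rw [← abs_mul, ← abs_mul]; exact abs_add_le _ _
      _ ≤ (K * ‖a - b‖ * (1 + (totalEnergy a + totalEnergy b)) ^ p) * 1
          + (K * (1 + (totalEnergy a + totalEnergy b)) ^ p) * (L * ‖a - b‖) := by
          gcongr
          exact (hf a b ha hb).2
      _ = K * (1 + L) * ‖a - b‖ * (1 + (totalEnergy a + totalEnergy b)) ^ p := by ring
      _ ≤ K * (1 + L) * ‖a - b‖ * (C * Real.exp (θ / 3 * (totalEnergy a + totalEnergy b))) := by
          gcongr
          exact hCexp _ (by positivity)
      _ = K * (1 + L) * C * ‖a - b‖ * Real.exp (θ / 3 * (totalEnergy a + totalEnergy b)) := by ring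
      _ ≤ _ := by gcongr; linarith
  refine dynkin_of_tendsto hch hA hpos hY hy hκ (by linarith) (K := K * (1 + L) * C + K)
    (by positivity) (F := F)
    (fun k => hfs.mul (χ.contDiff.comp (contDiff_const_smul (c k)))) hFc hFL (fun k => ?_)
    hfs.continuous.measurable (fun z _ => ?_) t
  · have h1 := (hf 0 0 le_rfl le_rfl).1
    have h2 : |χ (c k • (0 : ι → ℝ))| ≤ 1 := by
      rw [abs_of_nonneg χ.nonneg]; exact χ.le_one
    simp only [totalEnergy, Pi.zero_apply, Finset.sum_const_zero, add_zero, one_pow, mul_one] at h1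
    calc |F k 0| = |f 0| * |χ (c k • (0 : ι → ℝ))| := abs_mul _ _
      _ ≤ K * 1 := by gcongr
      _ ≤ K * (1 + L) * C + K := by
        have : 0 ≤ K * (1 + L) * C := by positivity
        linarith
  · have h1 : Tendsto c atTop (𝓝 0) := by
      simpa [c, one_div] using tendsto_one_div_add_atTop_nhds_zero_nat (𝕜 := ℝ)
    have h2 : Tendsto (fun k => χ (c k • z)) atTop (𝓝 (χ ((0 : ℝ) • z))) :=
      (χ.continuous.tendsto _).comp (h1.smul_const z)
    have h3 : χ ((0 : ℝ) • z) = 1 := by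
      rw [zero_smul]; exact χ.one_of_mem_closedBall (by simp [χ])
    rw [h3] at h2
    simpa using h2.const_mul (f z)

end JumpProcess

/-! ### Beta and Gamma integrals and the dual rates -/

section BetaGamma

theorem integral_rpow_mul_one_sub_rpow {a b : ℝ} (ha : 0 < a) (hb : 0 < b) :
    ∫ x in (0 : ℝ)..1, x ^ (a - 1) * (1 - x) ^ (b - 1)
      = Real.Gamma a * Real.Gamma b / Real.Gamma (a + b) := by
  apply Complex.ofReal_injective
  rw [← intervalIntegral.integral_ofReal]
  push_cast
  rw [← Complex.Gamma_ofReal, ← Complex.Gamma_ofReal, ← Complex.Gamma_ofReal, Complex.ofReal_add,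
    ← Complex.betaIntegral_eq_Gamma_mul_div _ _ (by simpa) (by simpa), Complex.betaIntegral]
  refine intervalIntegral.integral_congr fun x hx => ?_
  rw [Set.uIcc_of_le zero_le_one] at hx
  rw [Complex.ofReal_cpow hx.1, Complex.ofReal_cpow (sub_nonneg.2 hx.2)]
  push_cast
  rfl

theorem intervalIntegrable_one_sub_rpow {s : ℝ} (hs : 0 < s) :
    IntervalIntegrable (fun u : ℝ => (1 - u) ^ (2 * s - 1)) volume 0 1 := by
  have := (intervalIntegral.intervalIntegrable_rpow' (a := 0) (b := 1) (r := 2 * s - 1)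
    (by linarith)).comp_sub_left 1
  simpa using this.symm

/-- The normalization `Γ(2s) / Γ(2s + m)` of the duality function at a bulk site. -/
noncomputable def gammaRatio (s : ℝ) (m : ℕ) : ℝ := Real.Gamma (2 * s) / Real.Gamma (2 * s + m)

theorem gammaRatio_pos {s : ℝ} (hs : 0 < s) (m : ℕ) : 0 < gammaRatio s m :=
  div_pos (Real.Gamma_pos_of_pos (by positivity)) (Real.Gamma_pos_of_pos (by positivity))

/-- The factor `Γ(m - k + 2s)` cancels, and `m! / (k (m - k)!)` is `m.choose k * Γ(k)`. The
right-hand side is the form in which the coefficients emerge from the binomial expansion. -/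
theorem harmonicRate_mul_gammaRatio {s : ℝ} (hs : 0 < s) {k m : ℕ} (hk : 1 ≤ k) (hkm : k ≤ m) :
    harmonicRate s k m * gammaRatio s (m - k)
      = m.choose k * Real.Gamma k * gammaRatio s m := by
  have h1 : Real.Gamma (2 * s + m) ≠ 0 := (Real.Gamma_pos_of_pos (by positivity)).ne'
  have h2 : Real.Gamma (2 * s + (m - k : ℕ)) ≠ 0 := (Real.Gamma_pos_of_pos (by positivity)).ne'
  have hk0 : (k : ℝ) ≠ 0 := by positivity
  have h3 : Real.Gamma ((k : ℝ) + 1) = k * Real.Gamma k := Real.Gamma_add_one hk0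
  rw [Real.Gamma_nat_eq_factorial] at h3
  have h4 : (m.choose k : ℝ) * k.factorial * (m - k).factorial = m.factorial := by
    exact_mod_cast Nat.choose_mul_factorial_mul_factorial hkm
  have h5 : ((m - k).factorial : ℝ) ≠ 0 := by positivity
  rw [h3] at h4
  rw [harmonicRate, if_pos ⟨hk, hkm⟩, gammaRatio, gammaRatio, ← Nat.cast_sub hkm,
    Real.Gamma_nat_eq_factorial, Real.Gamma_nat_eq_factorial, ← h4, add_comm _ (2 * s),
    add_comm _ (2 * s)]
  field_simp

/-- The weight of the beta jumps. -/
noncomputable def betaKernel (s u : ℝ) : ℝ := u⁻¹ * (1 - u) ^ (2 * s - 1)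

theorem intervalIntegrable_betaKernel {s : ℝ} (hs : 0 < s) {k : ℕ} (hk : 1 ≤ k) (a : ℕ) :
    IntervalIntegrable (fun u => betaKernel s u * (u ^ k * (1 - u) ^ a)) volume 0 1 := by
  obtain ⟨k, rfl⟩ := Nat.exists_eq_add_of_le' hk
  refine ((intervalIntegrable_one_sub_rpow hs).mul_continuousOn
    (g := fun u : ℝ => u ^ k * (1 - u) ^ a) (by fun_prop)).congr_uIoo fun u hu => ?_
  rw [Set.uIoo_of_le zero_le_one] at hu
  have := hu.1.ne'
  simp only [betaKernel, pow_succ]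
  field_simp

/-- The integral is the Beta function at `(k, 2s + a)`; the normalization turns it into the one
belonging to `a + k` particles. -/
theorem gammaRatio_mul_integral_betaKernel {s : ℝ} (hs : 0 < s) {k : ℕ} (hk : 1 ≤ k) (a : ℕ) :
    gammaRatio s a * ∫ u in (0 : ℝ)..1, betaKernel s u * (u ^ k * (1 - u) ^ a)
      = Real.Gamma k * gammaRatio s (a + k) := by
  have h1 : ∫ u in (0 : ℝ)..1, betaKernel s u * (u ^ k * (1 - u) ^ a)
      = ∫ u in (0 : ℝ)..1, u ^ ((k : ℝ) - 1) * (1 - u) ^ (2 * s + a - 1) := by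
    refine intervalIntegral.integral_congr_uIoo fun u hu => ?_
    rw [Set.uIoo_of_le zero_le_one] at hu
    have h2 : 0 < 1 - u := sub_pos.2 hu.2
    simp only [betaKernel]
    rw [show 2 * s + (a : ℝ) - 1 = (2 * s - 1) + a by ring, Real.rpow_add h2, Real.rpow_natCast,
      Real.rpow_sub hu.1, Real.rpow_natCast, Real.rpow_one]
    ring
  have h3 : Real.Gamma (2 * s + a) ≠ 0 := (Real.Gamma_pos_of_pos (by positivity)).ne'
  rw [h1, integral_rpow_mul_one_sub_rpow (by positivity) (by positivity), gammaRatio, gammaRatio,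
    Nat.cast_add, show (k : ℝ) + (2 * s + a) = 2 * s + (a + k) by ring]
  field_simp

/-- With the term `k = 0` split off, every remaining term carries a factor `z`, which cancels the
singularity `u⁻¹` of the kernels. -/
theorem add_pow_eq_pow_add_sum (x z : ℝ) (m : ℕ) :
    (x + z) ^ m = x ^ m + ∑ k ∈ Finset.Icc 1 m, m.choose k * (z ^ k * x ^ (m - k)) := by
  rw [add_comm x z, add_pow, Finset.range_eq_Ico, Finset.sum_eq_sum_Ico_succ_bot (by omega)]
  have h2 : Finset.Ico (0 + 1) (m + 1) = Finset.Icc 1 m := by ext; simp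
  rw [h2]
  simp only [pow_zero, tsub_zero, one_mul, Nat.choose_zero_right, Nat.cast_one, mul_one]
  congr 1
  exact Finset.sum_congr rfl fun k _ => by ring

theorem one_sub_one_sub_pow (m : ℕ) (u : ℝ) :
    1 - (1 - u) ^ m = ∑ k ∈ Finset.Icc 1 m, m.choose k * (u ^ k * (1 - u) ^ (m - k)) := by
  have h := add_pow_eq_pow_add_sum (1 - u) u m
  rw [sub_add_cancel, one_pow] at h
  linarith

theorem intervalIntegrable_finset_sum {α : Type*} (S : Finset α) {F : α → ℝ → ℝ}
    (hF : ∀ i ∈ S, IntervalIntegrable (F i) volume 0 1) :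
    IntervalIntegrable (fun u => ∑ i ∈ S, F i u) volume 0 1 := by
  have := IntervalIntegrable.sum S hF
  rwa [Finset.sum_fn] at this

/-- The total rate at which `m` particles leave a site. -/
noncomputable def totalRate (s : ℝ) (m : ℕ) : ℝ := ∑ k ∈ Finset.Icc 1 m, harmonicRate s k m

theorem intervalIntegrable_betaKernel_one_sub_pow {s : ℝ} (hs : 0 < s) (m : ℕ) :
    IntervalIntegrable (fun u => betaKernel s u * (1 - (1 - u) ^ m)) volume 0 1 := by
  simp only [one_sub_one_sub_pow, Finset.mul_sum]
  refine intervalIntegrable_finset_sum _ fun k hk => ?_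
  refine ((intervalIntegrable_betaKernel hs (Finset.mem_Icc.1 hk).1 (m - k)).const_mul
    (m.choose k : ℝ)).congr fun u _ => ?_
  ring

theorem integral_betaKernel_one_sub_pow {s : ℝ} (hs : 0 < s) (m : ℕ) :
    ∫ u in (0 : ℝ)..1, betaKernel s u * (1 - (1 - u) ^ m) = totalRate s m := by
  have h1 : ∀ u, betaKernel s u * (1 - (1 - u) ^ m) = ∑ k ∈ Finset.Icc 1 m,
      m.choose k * (betaKernel s u * (u ^ k * (1 - u) ^ (m - k))) := fun u => by
    rw [one_sub_one_sub_pow, Finset.mul_sum]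
    exact Finset.sum_congr rfl fun k _ => by ring
  simp only [h1]
  rw [intervalIntegral.integral_finsetSum fun k hk =>
    (intervalIntegrable_betaKernel hs (Finset.mem_Icc.1 hk).1 (m - k)).const_mul _]
  refine Finset.sum_congr rfl fun k hk => ?_
  have hk := Finset.mem_Icc.1 hk
  have hd := (gammaRatio_pos hs (m - k)).ne'
  rw [intervalIntegral.integral_const_mul]
  apply mul_right_cancel₀ hd
  rw [harmonicRate_mul_gammaRatio hs hk.1 hk.2, mul_assoc, mul_comm _ (gammaRatio s (m - k)),
    gammaRatio_mul_integral_betaKernel hs hk.1, Nat.sub_add_cancel hk.2]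
  ring

theorem integral_betaKernel_removal {s : ℝ} (hs : 0 < s) (a : ℕ) (D : ℝ) :
    ∫ u in (0 : ℝ)..1, betaKernel s u * ((1 - u) ^ a * D - D) = -(totalRate s a * D) := by
  rw [← integral_betaKernel_one_sub_pow hs, ← intervalIntegral.integral_mul_const,
    ← intervalIntegral.integral_neg]
  congr 1; ext u; ring

/-- Expand `(z + u * x) ^ b`. The term `k = 0` leaves `(1 - u) ^ a - 1`, whose integral is minus the
total rate of `a` particles. The term of order `k` moves `k` units of exponent from `z` to `x`:
energy flows from `x` to `z`, particles flow back. -/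
theorem integral_betaKernel_transfer {s : ℝ} (hs : 0 < s) (a b : ℕ) (x z R : ℝ) :
    ∫ u in (0 : ℝ)..1, betaKernel s u
        * ((((1 - u) * x) ^ a * gammaRatio s a) * ((z + u * x) ^ b * gammaRatio s b) * R
          - (x ^ a * gammaRatio s a) * (z ^ b * gammaRatio s b) * R)
      = ∑ k ∈ Finset.Icc 1 b, harmonicRate s k b * ((z ^ (b - k) * gammaRatio s (b - k))
          * (x ^ (a + k) * gammaRatio s (a + k)) * R)
        - totalRate s a * ((x ^ a * gammaRatio s a) * (z ^ b * gammaRatio s b) * R) := by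
  set D := (x ^ a * gammaRatio s a) * (z ^ b * gammaRatio s b) * R with hD
  have h1 : ∀ u, betaKernel s u
      * ((((1 - u) * x) ^ a * gammaRatio s a) * ((z + u * x) ^ b * gammaRatio s b) * R - D)
      = (∑ k ∈ Finset.Icc 1 b, (b.choose k * z ^ (b - k) * x ^ (a + k) * gammaRatio s a
          * gammaRatio s b * R) * (betaKernel s u * (u ^ k * (1 - u) ^ a)))
        - D * (betaKernel s u * (1 - (1 - u) ^ a)) := fun u => by
    rw [add_pow_eq_pow_add_sum, mul_pow, add_mul (z ^ b), Finset.sum_mul, mul_add, add_mul,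
      Finset.mul_sum, Finset.sum_mul, add_sub_right_comm, mul_add, Finset.mul_sum, hD, add_comm,
      sub_eq_add_neg]
    congr 1
    · exact Finset.sum_congr rfl fun k _ => by ring
    · ring
  simp only [h1]
  have hi := fun k (hk : k ∈ Finset.Icc 1 b) =>
    intervalIntegrable_betaKernel hs (Finset.mem_Icc.1 hk).1 a
  rw [intervalIntegral.integral_sub
      (intervalIntegrable_finset_sum _ fun k hk => (hi k hk).const_mul _)
      ((intervalIntegrable_betaKernel_one_sub_pow hs a).const_mul _),
    intervalIntegral.integral_finsetSum fun k hk => (hi k hk).const_mul _,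
    intervalIntegral.integral_const_mul, integral_betaKernel_one_sub_pow hs, mul_comm D]
  congr 1
  refine Finset.sum_congr rfl fun k hk => ?_
  have hk := Finset.mem_Icc.1 hk
  have e1 := harmonicRate_mul_gammaRatio hs hk.1 hk.2
  have e2 := gammaRatio_mul_integral_betaKernel hs hk.1 a
  rw [intervalIntegral.integral_const_mul]
  calc _ = b.choose k * z ^ (b - k) * x ^ (a + k) * gammaRatio s b * R * (gammaRatio s a *
        ∫ u in (0 : ℝ)..1, betaKernel s u * (u ^ k * (1 - u) ^ a)) := by ring
    _ = (b.choose k * Real.Gamma k * gammaRatio s b) * (z ^ (b - k) * x ^ (a + k)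
        * gammaRatio s (a + k) * R) := by rw [e2]; ring
    _ = _ := by rw [← e1]; ring

/-- The weight of the reservoir jumps. -/
noncomputable def gammaKernel (lam u : ℝ) : ℝ := u⁻¹ * Real.exp (-lam * u)

theorem gammaKernel_mul_pow {lam u : ℝ} (hu : 0 < u) (k : ℕ) :
    gammaKernel lam u * u ^ k = u ^ ((k : ℝ) - 1) * Real.exp (-(lam * u)) := by
  rw [gammaKernel, Real.rpow_sub hu, Real.rpow_natCast, Real.rpow_one, neg_mul]
  ring

theorem integral_gammaKernel {lam : ℝ} (hl : 0 < lam) {k : ℕ} (hk : 1 ≤ k) :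
    ∫ u in Set.Ioi (0 : ℝ), gammaKernel lam u * u ^ k = Real.Gamma k * (1 / lam) ^ k := by
  rw [setIntegral_congr_fun measurableSet_Ioi fun u hu => gammaKernel_mul_pow hu k,
    Real.integral_rpow_mul_exp_neg_mul_Ioi (by positivity) hl, Real.rpow_natCast, mul_comm]

theorem integrableOn_gammaKernel {lam : ℝ} (hl : 0 < lam) {k : ℕ} (hk : 1 ≤ k) :
    IntegrableOn (fun u => gammaKernel lam u * u ^ k) (Set.Ioi 0) := by
  -- A nonzero integral certifies integrability, because the default value is `0`.
  refine not_imp_comm.1 integral_undef ?_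
  rw [integral_gammaKernel hl hk]
  have := Real.Gamma_pos_of_pos (s := k) (by positivity)
  positivity

/-- Here the term `k = 0` cancels completely, so only gains remain; the term of order `k` exchanges
`x ^ k` for `(1 / lam) ^ k`, the absorption of `k` particles. -/
theorem integral_gammaKernel_injection {s lam : ℝ} (hs : 0 < s) (hl : 0 < lam) (b c : ℕ) (x R : ℝ) :
    ∫ u in Set.Ioi (0 : ℝ), gammaKernel lam u
        * (((x + u) ^ b * gammaRatio s b) * (1 / lam) ^ c * R
          - (x ^ b * gammaRatio s b) * (1 / lam) ^ c * R)
      = ∑ k ∈ Finset.Icc 1 b, harmonicRate s k b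
          * ((x ^ (b - k) * gammaRatio s (b - k)) * (1 / lam) ^ (c + k) * R) := by
  have h1 : ∀ u, gammaKernel lam u * (((x + u) ^ b * gammaRatio s b) * (1 / lam) ^ c * R
      - (x ^ b * gammaRatio s b) * (1 / lam) ^ c * R)
      = ∑ k ∈ Finset.Icc 1 b, (b.choose k * x ^ (b - k) * gammaRatio s b * (1 / lam) ^ c * R)
        * (gammaKernel lam u * u ^ k) := fun u => by
    rw [add_pow_eq_pow_add_sum, add_mul, add_mul, add_mul, add_sub_cancel_left, Finset.sum_mul,
      Finset.sum_mul, Finset.sum_mul, Finset.mul_sum]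
    exact Finset.sum_congr rfl fun k _ => by ring
  simp only [h1]
  rw [integral_finsetSum _ fun k hk =>
    (integrableOn_gammaKernel hl (Finset.mem_Icc.1 hk).1).const_mul _]
  refine Finset.sum_congr rfl fun k hk => ?_
  have hk := Finset.mem_Icc.1 hk
  have e1 := harmonicRate_mul_gammaRatio hs hk.1 hk.2
  rw [integral_const_mul, integral_gammaKernel hl hk.1]
  calc _ = (b.choose k * Real.Gamma k * gammaRatio s b) * (x ^ (b - k) * (1 / lam) ^ (c + k) * R) := by
        rw [pow_add]; ring
    _ = _ := by rw [← e1]; ring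

end BetaGamma

/-! ### The heat conduction generator as a sum of jump operators -/

section HeatChannels

/-- The rate of the beta jumps, carried by `(0, 1)`. -/
noncomputable def betaWeight (s u : ℝ) : ℝ := if u < 1 then betaKernel s u else 0

theorem integral_Ioi_betaWeight_mul (s : ℝ) (g : ℝ → ℝ) :
    ∫ u in Set.Ioi (0 : ℝ), betaWeight s u * g u = ∫ u in (0 : ℝ)..1, betaKernel s u * g u := by
  have h1 : (fun u => betaWeight s u * g u)
      = Set.indicator (Set.Iio 1) (fun u => betaKernel s u * g u) := by
    ext u
    by_cases hu : u < 1 <;> simp [betaWeight, hu]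
  rw [h1, setIntegral_indicator measurableSet_Iio, Set.Ioi_inter_Iio,
    intervalIntegral.integral_of_le zero_le_one, integral_Ioc_eq_integral_Ioo]

/-- Substitute `α = u * x`: the measure `dα / α` is scale invariant, so the rate no longer depends
on the configuration. -/
theorem integral_rescale {s x : ℝ} (hx : x ≠ 0) (g : ℝ → ℝ) :
    ∫ α in (0 : ℝ)..x, 1 / α * (1 - α / x) ^ (2 * s - 1) * g α
      = ∫ u in (0 : ℝ)..1, betaKernel s u * g (u * x) := by
  have h := intervalIntegral.integral_comp_mul_right (a := 0) (b := 1)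
    (fun α => 1 / α * (1 - α / x) ^ (2 * s - 1) * g α) hx
  rw [zero_mul, one_mul, smul_eq_mul, eq_inv_mul_iff_mul_eq₀ hx,
    ← intervalIntegral.integral_const_mul] at h
  rw [← h]
  refine intervalIntegral.integral_congr fun u _ => ?_
  simp only [betaKernel, mul_div_cancel_right₀ _ hx, one_div, mul_inv]
  field_simp

variable {N : ℕ}

/-- The jump moving the fraction `u` of the energy at `i` to `j`. -/
def transferJump (i j : Fin N) (y : Fin N → ℝ) (u : ℝ) : Fin N → ℝ :=
  y - Pi.single i (u * y i) + Pi.single j (u * y i)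

/-- The jump removing the fraction `u` of the energy at `i`. -/
def removalJump (i : Fin N) (y : Fin N → ℝ) (u : ℝ) : Fin N → ℝ := y - Pi.single i (u * y i)

/-- The jump adding the energy `u` at `i`. -/
def injectionJump (i : Fin N) (y : Fin N → ℝ) (u : ℝ) : Fin N → ℝ := y + Pi.single i u

theorem energyTransfer_eq (s : ℝ) (i j : Fin N) (f : (Fin N → ℝ) → ℝ) {y : Fin N → ℝ}
    (hy : 0 < y i) :
    energyTransfer s i j f y = jumpOperator (betaWeight s) (transferJump i j) f y := by
  rw [jumpOperator, integral_Ioi_betaWeight_mul]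
  exact integral_rescale hy.ne' (fun α => f (y - Pi.single i α + Pi.single j α) - f y)

theorem energyRemoval_eq (s : ℝ) (i : Fin N) (f : (Fin N → ℝ) → ℝ) {y : Fin N → ℝ} (hy : 0 < y i) :
    energyRemoval s i f y = jumpOperator (betaWeight s) (removalJump i) f y := by
  rw [jumpOperator, integral_Ioi_betaWeight_mul]
  exact integral_rescale hy.ne' (fun α => f (y - Pi.single i α) - f y)

theorem energyInjection_eq (lam : ℝ) (i : Fin N) (f : (Fin N → ℝ) → ℝ) (y : Fin N → ℝ) :
    energyInjection lam i f y = jumpOperator (gammaKernel lam) (injectionJump i) f y := by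
  simp only [energyInjection, jumpOperator, gammaKernel, one_div, injectionJump]

theorem measurable_betaWeight (s : ℝ) : Measurable (betaWeight s) :=
  Measurable.ite measurableSet_Iio
    (measurable_inv.mul ((measurable_const.sub measurable_id).pow_const _)) measurable_const

theorem betaWeight_nonneg (s : ℝ) {u : ℝ} (hu : 0 < u) : 0 ≤ betaWeight s u := by
  unfold betaWeight
  split_ifs with h
  · exact mul_nonneg (inv_nonneg.2 hu.le) (Real.rpow_nonneg (by linarith) _)
  · exact le_rfl

theorem lt_one_of_betaWeight_ne_zero {s u : ℝ} (h : betaWeight s u ≠ 0) : u < 1 := by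
  by_contra h1
  exact h (if_neg h1)

theorem integrableOn_betaWeight {s : ℝ} (hs : 0 < s) (θ : ℝ) :
    IntegrableOn (fun u => betaWeight s u * (u * Real.exp (θ * u))) (Set.Ioi 0) := by
  have h1 : IntegrableOn (fun u => (1 - u) ^ (2 * s - 1) * Real.exp (θ * u)) (Set.Ioo 0 1) := by
    have := ((intervalIntegrable_one_sub_rpow hs).mul_continuousOn
      (g := fun u => Real.exp (θ * u)) (by fun_prop))
    rw [intervalIntegrable_iff_integrableOn_Ioc_of_le zero_le_one] at this
    exact this.mono_set Set.Ioo_subset_Ioc_self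
  have h2 : IntegrableOn ((Set.Iio (1 : ℝ)).indicator
      fun u => (1 - u) ^ (2 * s - 1) * Real.exp (θ * u)) (Set.Ioi 0) := by
    rw [integrableOn_indicator_iff measurableSet_Iio, Set.inter_comm, Set.Ioi_inter_Iio]
    exact h1
  refine h2.congr_fun (fun u hu => ?_) measurableSet_Ioi
  have hu : 0 < u := hu
  by_cases h : u < 1
  · simp only [Set.indicator, Set.mem_Iio, h, if_true, betaWeight, betaKernel]
    field_simp
  · simp [betaWeight, h]

theorem totalEnergy_single (i : Fin N) (c : ℝ) : totalEnergy (Pi.single i c : Fin N → ℝ) = c := by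
  simp [totalEnergy]

theorem totalEnergy_add (y z : Fin N → ℝ) :
    totalEnergy (y + z) = totalEnergy y + totalEnergy z := by
  simp [totalEnergy, Finset.sum_add_distrib]

theorem totalEnergy_sub (y z : Fin N → ℝ) :
    totalEnergy (y - z) = totalEnergy y - totalEnergy z := by
  simp [totalEnergy]

theorem removalJump_nonneg {i : Fin N} {y : Fin N → ℝ} {u : ℝ} (hy : 0 ≤ y) (hu : u < 1) :
    0 ≤ removalJump i y u := by
  intro k
  have hk := hy k
  simp only [removalJump, Pi.sub_apply, Pi.zero_apply] at hk ⊢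
  rcases eq_or_ne k i with rfl | h
  · rw [Pi.single_eq_same]; nlinarith
  · simpa [h] using hk

theorem isJumpChannel_removal {s : ℝ} (hs : 0 < s) (θ : ℝ) (i : Fin N) :
    IsJumpChannel θ (betaWeight s) (removalJump i) where
  measurable_weight := measurable_betaWeight s
  weight_nonneg _ hu := betaWeight_nonneg s hu
  integrable := integrableOn_betaWeight hs θ
  measurable_jump := by
    refine measurable_pi_lambda _ fun k => ?_
    have hi : Measurable (fun p : (Fin N → ℝ) × ℝ => p.2 * p.1 i) := by fun_prop
    have hk : Measurable (fun p : (Fin N → ℝ) × ℝ => p.1 k) := by fun_prop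
    by_cases h : k = i
    · subst h; simpa [removalJump, Pi.sub_def] using hk.sub hi
    · simpa [removalJump, h] using hk
  jump_nonneg y u hy _ hw := removalJump_nonneg hy (lt_one_of_betaWeight_ne_zero hw)
  total_le y u hy hu := by
    rw [removalJump, totalEnergy_sub, totalEnergy_single]
    have := mul_nonneg hu.le (hy i)
    linarith
  total_ge y u hy hu := by
    rw [removalJump, totalEnergy_sub, totalEnergy_single]
    have := mul_le_mul_of_nonneg_left (le_totalEnergy hy i) hu.le
    linarith
  norm_sub_le y u hy hu := by
    have h1 : removalJump i y u - y = -Pi.single i (u * y i) := by simp [removalJump]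
    rw [h1, norm_neg, Pi.norm_single, Real.norm_of_nonneg (mul_nonneg hu.le (hy i))]
    exact mul_le_mul_of_nonneg_left ((le_totalEnergy hy i).trans (by linarith)) hu.le

/-- The moment integrand is `exp (-(lam - θ) * u)`; this is the only channel that restricts `θ`. -/
theorem isJumpChannel_injection {θ lam : ℝ} (h : θ < lam) (i : Fin N) :
    IsJumpChannel θ (gammaKernel lam) (injectionJump i) where
  measurable_weight := by unfold gammaKernel; fun_prop
  weight_nonneg _ hu := mul_nonneg (inv_nonneg.2 hu.le) (Real.exp_pos _).le
  integrable := by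
    refine (exp_neg_integrableOn_Ioi 0 (sub_pos.2 h)).congr_fun (fun u hu => ?_) measurableSet_Ioi
    have hu : 0 < u := hu
    simp only [gammaKernel]
    rw [show -(lam - θ) * u = -lam * u + θ * u by ring, Real.exp_add]
    field_simp
  measurable_jump := by
    refine measurable_pi_lambda _ fun k => ?_
    have hk : Measurable (fun p : (Fin N → ℝ) × ℝ => p.1 k) := by fun_prop
    by_cases h : k = i
    · subst h; simpa [injectionJump, Pi.add_def] using hk.add measurable_snd
    · simpa [injectionJump, h] using hk
  jump_nonneg y u hy hu _ := add_nonneg hy (Pi.single_nonneg.2 hu.le)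
  total_le y u hy hu := by
    rw [injectionJump, totalEnergy_add, totalEnergy_single]
  total_ge y u hy hu := by
    rw [injectionJump, totalEnergy_add, totalEnergy_single]
    have := mul_nonneg hu.le (totalEnergy_nonneg hy)
    linarith
  norm_sub_le y u hy hu := by
    have h1 : injectionJump i y u - y = Pi.single i u := by simp [injectionJump]
    rw [h1, Pi.norm_single, Real.norm_of_nonneg hu.le]
    exact le_mul_of_one_le_right hu.le (by linarith [totalEnergy_nonneg hy])

theorem isJumpChannel_transfer {s : ℝ} (hs : 0 < s) (θ : ℝ) {i j : Fin N} (hij : i ≠ j) :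
    IsJumpChannel θ (betaWeight s) (transferJump i j) where
  measurable_weight := measurable_betaWeight s
  weight_nonneg _ hu := betaWeight_nonneg s hu
  integrable := integrableOn_betaWeight hs θ
  measurable_jump := by
    refine measurable_pi_lambda _ fun k => ?_
    have hi : Measurable (fun p : (Fin N → ℝ) × ℝ => p.2 * p.1 i) := by fun_prop
    have hk : Measurable (fun p : (Fin N → ℝ) × ℝ => p.1 k) := by fun_prop
    by_cases h : k = i
    · subst h; simpa [transferJump, hij, Pi.sub_def] using hk.sub hi
    · by_cases h' : k = j
      · subst h'; simpa [transferJump, h, Pi.add_def] using hk.add hi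
      · simpa [transferJump, h, h'] using hk
  jump_nonneg y u hy hu hw := add_nonneg (removalJump_nonneg hy (lt_one_of_betaWeight_ne_zero hw))
    (Pi.single_nonneg.2 (mul_nonneg hu.le (hy i)))
  total_le y u hy hu := by
    rw [transferJump, totalEnergy_add, totalEnergy_sub, totalEnergy_single, totalEnergy_single]
    linarith
  total_ge y u hy hu := by
    rw [transferJump, totalEnergy_add, totalEnergy_sub, totalEnergy_single, totalEnergy_single]
    have := mul_nonneg hu.le (totalEnergy_nonneg hy)
    linarith
  norm_sub_le y u hy hu := by
    have hi := mul_nonneg hu.le (hy i)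
    have hS := totalEnergy_nonneg hy
    refine le_trans ?_ (mul_le_mul_of_nonneg_left ((le_totalEnergy hy i).trans
      (by linarith : totalEnergy y ≤ 1 + totalEnergy y)) hu.le)
    refine (pi_norm_le_iff_of_nonneg hi).2 fun k => ?_
    rw [Real.norm_eq_abs]
    by_cases h : k = i
    · subst h; simp [transferJump, hij, abs_of_nonneg (hy k), abs_of_pos hu]
    · by_cases h' : k = j
      · subst h'; simp [transferJump, h, abs_of_nonneg (hy i), abs_of_pos hu]
      · simpa [transferJump, h, h'] using hi

variable {n : ℕ}

/-- The jump rates of the heat conduction model. -/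
noncomputable def heatWeight (s lamL lamR : ℝ) : Fin 4 ⊕ (Fin n ⊕ Fin n) → ℝ → ℝ :=
  Sum.elim ![betaWeight s, gammaKernel lamL, betaWeight s, gammaKernel lamR] fun _ => betaWeight s

/-- The jump maps of the heat conduction model. -/
def heatJump : Fin 4 ⊕ (Fin n ⊕ Fin n) → (Fin (n + 1) → ℝ) → ℝ → Fin (n + 1) → ℝ :=
  Sum.elim ![removalJump 0, injectionJump 0, removalJump (Fin.last n), injectionJump (Fin.last n)]
    (Sum.elim (fun i => transferJump i.castSucc i.succ) fun i => transferJump i.succ i.castSucc)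

theorem isJumpChannel_heat {s θ lamL lamR : ℝ} (hs : 0 < s) (hL : θ < lamL) (hR : θ < lamR)
    (c : Fin 4 ⊕ (Fin n ⊕ Fin n)) :
    IsJumpChannel θ (heatWeight s lamL lamR c) (heatJump c) := by
  rcases c with c | c | c
  · fin_cases c
    · exact isJumpChannel_removal hs θ 0
    · exact isJumpChannel_injection hL 0
    · exact isJumpChannel_removal hs θ (Fin.last n)
    · exact isJumpChannel_injection hR (Fin.last n)
  · exact isJumpChannel_transfer hs θ (Fin.castSucc_lt_succ).ne
  · exact isJumpChannel_transfer hs θ (Fin.castSucc_lt_succ).ne'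

theorem heatGenerator_eq_jumpSum (s lamL lamR : ℝ) (f : (Fin (n + 1) → ℝ) → ℝ)
    (y : Fin (n + 1) → ℝ) (hy : ∀ i, 0 < y i) :
    heatGenerator s lamL lamR f y = jumpSum (heatWeight s lamL lamR) heatJump f y := by
  simp only [heatGenerator, jumpSum, Fintype.sum_sum_type, Fin.sum_univ_four,
    Finset.sum_add_distrib, energyTransfer_eq _ _ _ _ (hy _), energyRemoval_eq _ _ _ (hy _),
    energyInjection_eq]
  simp only [heatWeight, heatJump, Sum.elim_inl, Sum.elim_inr, Matrix.cons_val]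
  ring

end HeatChannels

/-! ### Duality of the generators -/

section Duality

theorem prod_eq_mul_mul_prod_compl {M : ℕ} {a b : Fin M} (hab : a ≠ b) (h : Fin M → ℝ) :
    ∏ v, h v = h a * h b * ∏ v ∈ ({a, b} : Finset (Fin M))ᶜ, h v := by
  rw [← Finset.prod_mul_prod_compl {a, b}, Finset.prod_pair hab]

theorem prod_congr_compl_pair {M : ℕ} {a b : Fin M} {h h' : Fin M → ℝ}
    (hh : ∀ v, v ≠ a → v ≠ b → h' v = h v) :
    ∏ v ∈ ({a, b} : Finset (Fin M))ᶜ, h' v = ∏ v ∈ ({a, b} : Finset (Fin M))ᶜ, h v :=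
  Finset.prod_congr rfl fun v hv => by
    simp only [Finset.mem_compl, Finset.mem_insert, Finset.mem_singleton, not_or] at hv
    exact hh v hv.1 hv.2

/-- A jump changes only two factors of a product function. Separating gains from losses isolates the
diagonal term that must cancel between channels. -/
theorem particleTransfer_prod {M : ℕ} (s : ℝ) {a b : Fin M} (hab : a ≠ b) (G : Fin M → ℕ → ℝ)
    (ξ : Fin M → ℕ) :
    particleTransfer s a b (fun η => ∏ v, G v (η v)) ξ
      = ∑ k ∈ Finset.Icc 1 (ξ a), harmonicRate s k (ξ a) * (G a (ξ a - k) * G b (ξ b + k)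
          * ∏ v ∈ ({a, b} : Finset (Fin M))ᶜ, G v (ξ v))
        - totalRate s (ξ a) * ∏ v, G v (ξ v) := by
  rw [particleTransfer, totalRate, Finset.sum_mul, ← Finset.sum_sub_distrib]
  refine Finset.sum_congr rfl fun k _ => ?_
  rw [mul_sub, prod_eq_mul_mul_prod_compl hab
      (fun v => G v ((ξ - (Pi.single a k : Fin M → ℕ) + (Pi.single b k : Fin M → ℕ)) v)),
    prod_congr_compl_pair (h := fun v => G v (ξ v)) fun v hva hvb => by simp [hva, hvb]]
  simp [hab, hab.symm]

variable {n : ℕ}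

/-- The factors of the duality function. -/
noncomputable def siteFactor (s lamL lamR : ℝ) (y : Fin (n + 1) → ℝ) : Fin (n + 3) → ℕ → ℝ :=
  Fin.cons (fun m => (1 / lamL) ^ m)
    (Fin.snoc (fun i m => y i ^ m * gammaRatio s m) fun m => (1 / lamR) ^ m :
      Fin (n + 2) → ℕ → ℝ)

variable {s lamL lamR : ℝ} {y : Fin (n + 1) → ℝ} {ξ : Fin (n + 3) → ℕ}

theorem siteFactor_zero (m : ℕ) : siteFactor s lamL lamR y 0 m = (1 / lamL) ^ m := rfl

theorem siteFactor_last (m : ℕ) :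
    siteFactor s lamL lamR y (Fin.last (n + 2)) m = (1 / lamR) ^ m := by
  rw [← Fin.succ_last]
  simp [siteFactor]

theorem siteFactor_bulkSite (i : Fin (n + 1)) (m : ℕ) :
    siteFactor s lamL lamR y (bulkSite i) m = y i ^ m * gammaRatio s m := by
  simp [siteFactor, bulkSite]

theorem bulkSite_injective : Function.Injective (bulkSite : Fin (n + 1) → Fin (n + 3)) :=
  (Fin.succ_injective _).comp (Fin.castSucc_injective _)

theorem bulkSite_ne_zero (i : Fin (n + 1)) : bulkSite i ≠ 0 := Fin.succ_ne_zero _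

theorem bulkSite_ne_last (i : Fin (n + 1)) : bulkSite i ≠ Fin.last (n + 2) := by
  rw [← Fin.succ_last]
  exact fun h => (Fin.castSucc_lt_last i).ne (Fin.succ_injective _ h)

theorem eq_zero_or_last_or_bulkSite (v : Fin (n + 3)) :
    v = 0 ∨ v = Fin.last (n + 2) ∨ ∃ i, v = bulkSite i := by
  refine Fin.cases (Or.inl rfl) (fun v => Or.inr ?_) v
  refine Fin.lastCases (Or.inl (Fin.succ_last _)) (fun i => Or.inr ⟨i, rfl⟩) v

theorem dualityFunction_eq_prod :
    dualityFunction s lamL lamR y ξ = ∏ v, siteFactor s lamL lamR y v (ξ v) := by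
  rw [Fin.prod_univ_succ, Fin.prod_univ_castSucc, Fin.succ_last, siteFactor_zero, siteFactor_last,
    dualityFunction, mul_assoc]
  congr 2
  exact Finset.prod_congr rfl fun i _ => (siteFactor_bulkSite i _).symm

theorem siteFactor_congr {y' : Fin (n + 1) → ℝ} {v : Fin (n + 3)}
    (h : ∀ i, v = bulkSite i → y' i = y i) :
    siteFactor s lamL lamR y' v = siteFactor s lamL lamR y v := by
  ext m
  rcases eq_zero_or_last_or_bulkSite v with rfl | rfl | ⟨i, rfl⟩
  · rfl
  · rw [siteFactor_last, siteFactor_last]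
  · rw [siteFactor_bulkSite, siteFactor_bulkSite, h i rfl]

/-- One direction of a bond is dual to the opposite direction only up to diagonal terms; these are
antisymmetric in `i` and `j` and disappear when both directions are added. -/
theorem jumpOperator_transfer_dualityFunction (hs : 0 < s) {i j : Fin (n + 1)} (hij : i ≠ j) :
    jumpOperator (betaWeight s) (transferJump i j) (fun z => dualityFunction s lamL lamR z ξ) y
      = particleTransfer s (bulkSite j) (bulkSite i) (dualityFunction s lamL lamR y) ξ
        + totalRate s (ξ (bulkSite j)) * dualityFunction s lamL lamR y ξ
        - totalRate s (ξ (bulkSite i)) * dualityFunction s lamL lamR y ξ := by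
  have hne : bulkSite i ≠ bulkSite j := bulkSite_injective.ne hij
  have hD : dualityFunction s lamL lamR y = fun η => ∏ v, siteFactor s lamL lamR y v (η v) :=
    funext fun η => dualityFunction_eq_prod
  set R := ∏ v ∈ ({bulkSite i, bulkSite j} : Finset (Fin (n + 3)))ᶜ, siteFactor s lamL lamR y v (ξ v)
    with hR
  rw [hD, particleTransfer_prod s hne.symm, sub_add_cancel, Finset.pair_comm, ← hR,
    jumpOperator, integral_Ioi_betaWeight_mul]
  simp only [dualityFunction_eq_prod, prod_eq_mul_mul_prod_compl hne, siteFactor_bulkSite]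
  rw [← integral_betaKernel_transfer hs (ξ (bulkSite i)) (ξ (bulkSite j)) (y i) (y j) R]
  congr 1
  ext u
  rw [prod_congr_compl_pair (h := fun v => siteFactor s lamL lamR y v (ξ v)) fun v hvi hvj => ?_]
  · rw [← hR]
    simp [transferJump, hij, hij.symm, sub_mul]
  · refine congrFun (siteFactor_congr fun k hk => ?_) _
    have hki : k ≠ i := fun h => hvi (by rw [hk, h])
    have hkj : k ≠ j := fun h => hvj (by rw [hk, h])
    simp [transferJump, hki, hkj]

theorem jumpOperator_removal_dualityFunction (hs : 0 < s) (i : Fin (n + 1)) :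
    jumpOperator (betaWeight s) (removalJump i) (fun z => dualityFunction s lamL lamR z ξ) y
      = -(totalRate s (ξ (bulkSite i)) * dualityFunction s lamL lamR y ξ) := by
  rw [jumpOperator, integral_Ioi_betaWeight_mul, ← integral_betaKernel_removal hs]
  congr 1
  ext u
  -- The left reservoir is a dummy partner that makes the two-site factorization available; its
  -- factor does not change.
  have h0 := bulkSite_ne_zero i
  rw [dualityFunction_eq_prod, dualityFunction_eq_prod, prod_eq_mul_mul_prod_compl h0,
    prod_eq_mul_mul_prod_compl h0,
    prod_congr_compl_pair (h := fun v => siteFactor s lamL lamR y v (ξ v)) fun v hvi _ => ?_]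
  · simp only [siteFactor_bulkSite, siteFactor_zero]
    have : removalJump i y u i = (1 - u) * y i := by simp [removalJump, sub_mul]
    rw [this, mul_pow]
    ring
  · refine congrFun (siteFactor_congr fun k hk => ?_) _
    have hki : k ≠ i := fun h => hvi (by rw [hk, h])
    simp [removalJump, hki]

/-- The absorbing site `b` is kept abstract so that one statement serves both ends of the chain. -/
theorem jumpOperator_injection_dualityFunction (hs : 0 < s) {lam : ℝ} (hl : 0 < lam)
    (i : Fin (n + 1)) {b : Fin (n + 3)} (hb : ∀ j, bulkSite j ≠ b)
    (hfac : ∀ (z : Fin (n + 1) → ℝ) m, siteFactor s lamL lamR z b m = (1 / lam) ^ m) :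
    jumpOperator (gammaKernel lam) (injectionJump i) (fun z => dualityFunction s lamL lamR z ξ) y
      = particleTransfer s (bulkSite i) b (dualityFunction s lamL lamR y) ξ
        + totalRate s (ξ (bulkSite i)) * dualityFunction s lamL lamR y ξ := by
  have hD : dualityFunction s lamL lamR y = fun η => ∏ v, siteFactor s lamL lamR y v (η v) :=
    funext fun η => dualityFunction_eq_prod
  set R := ∏ v ∈ ({bulkSite i, b} : Finset (Fin (n + 3)))ᶜ, siteFactor s lamL lamR y v (ξ v)
    with hR
  rw [hD, particleTransfer_prod s (hb i), sub_add_cancel, ← hR, jumpOperator]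
  simp only [dualityFunction_eq_prod, prod_eq_mul_mul_prod_compl (hb i), siteFactor_bulkSite, hfac]
  rw [← integral_gammaKernel_injection hs hl (ξ (bulkSite i)) (ξ b) (y i) R]
  congr 1
  ext u
  rw [prod_congr_compl_pair (h := fun v => siteFactor s lamL lamR y v (ξ v)) fun v hvi _ => ?_]
  · rw [← hR]
    simp [injectionJump]
  · refine congrFun (siteFactor_congr fun k hk => ?_) _
    have hki : k ≠ i := fun h => hvi (by rw [hk, h])
    simp [injectionJump, hki]

/-- Duality of the generators. -/
theorem jumpSum_dualityFunction (hs : 0 < s) (hL : 0 < lamL) (hR : 0 < lamR) :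
    jumpSum (heatWeight s lamL lamR) heatJump (fun z => dualityFunction s lamL lamR z ξ) y
      = dualGenerator s (dualityFunction s lamL lamR y) ξ := by
  simp only [jumpSum, Fintype.sum_sum_type, Fin.sum_univ_four]
  simp only [heatWeight, heatJump, Sum.elim_inl, Sum.elim_inr, Matrix.cons_val]
  simp only [jumpOperator_removal_dualityFunction hs,
    jumpOperator_injection_dualityFunction hs hL 0 bulkSite_ne_zero fun _ => siteFactor_zero,
    jumpOperator_injection_dualityFunction hs hR (Fin.last n) bulkSite_ne_last
      fun _ => siteFactor_last,
    jumpOperator_transfer_dualityFunction hs Fin.castSucc_lt_succ.ne,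
    jumpOperator_transfer_dualityFunction hs Fin.castSucc_lt_succ.ne']
  rw [← Finset.sum_add_distrib, dualGenerator]
  -- At each end the loss from removal cancels the diagonal term of injection.
  have : ∀ a b c d e : ℝ, -a + (b + a) + -c + (d + c) + e = b + e + d := fun a b c d e => by ring
  rw [this]
  congr 2
  exact Finset.sum_congr rfl fun i _ => by ring

theorem contDiff_dualityFunction :
    ContDiff ℝ (⊤ : ℕ∞) (fun z => dualityFunction s lamL lamR z ξ) := by
  unfold dualityFunction
  exact (contDiff_const.mul (contDiff_prod fun i _ =>
    ((contDiff_apply ℝ ℝ i).pow _).mul contDiff_const)).mul contDiff_const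

theorem polyLipschitz_dualityFunction :
    PolyLipschitz (fun z => dualityFunction s lamL lamR z ξ) := by
  have h := ((polyLipschitz_const ((1 / lamL) ^ ξ 0 * (∏ i : Fin (n + 1),
    (Real.Gamma (2 * s) / Real.Gamma (2 * s + ξ (bulkSite i)))))).mul
      (polyLipschitz_prod_pow fun i : Fin (n + 1) => ξ (bulkSite i))).mul
        (polyLipschitz_const ((1 / lamR) ^ ξ (Fin.last (n + 2))))
  convert h using 2 with z
  rw [dualityFunction, Finset.prod_mul_distrib]
  ring

end Duality

/-! ### The dual process on a finite set of configurations -/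

section DualProcess

variable {n M : ℕ} {s : ℝ}

/-- The indicator function of a particle configuration. -/
noncomputable def pointMass (η x : Fin M → ℕ) : ℝ := if x = η then 1 else 0

/-- The bound on `k` matters: truncated subtraction would otherwise create particles. -/
theorem sum_jump_eq {a b : Fin M} {η : Fin M → ℕ} {k : ℕ} (hk : k ≤ η a) :
    ∑ v, (η - Pi.single a k + Pi.single b k : Fin M → ℕ) v = ∑ v, η v := by
  have h1 : (Pi.single a k : Fin M → ℕ) ≤ η := by
    intro v
    rcases eq_or_ne v a with rfl | h
    · simpa using hk
    · simp [h]
  have h2 : ∑ v, η v = ∑ v, (η - Pi.single a k + Pi.single a k : Fin M → ℕ) v := by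
    rw [tsub_add_cancel_of_le h1]
  rw [h2]
  simp [Finset.sum_add_distrib]

theorem particleTransfer_congr {a b : Fin M} {f g : (Fin M → ℕ) → ℝ} {η : Fin M → ℕ}
    (h : ∀ x : Fin M → ℕ, ∑ v, x v = ∑ v, η v → f x = g x) :
    particleTransfer s a b f η = particleTransfer s a b g η :=
  Finset.sum_congr rfl fun k hk => by
    rw [h η rfl, h _ (sum_jump_eq (Finset.mem_Icc.1 hk).2)]

/-- Conservation of particles at the level of the generator, which reduces the dual dynamics to
finite matrices. -/
theorem dualGenerator_congr {f g : (Fin (n + 3) → ℕ) → ℝ} {η : Fin (n + 3) → ℕ}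
    (h : ∀ x : Fin (n + 3) → ℕ, ∑ v, x v = ∑ v, η v → f x = g x) :
    dualGenerator s f η = dualGenerator s g η := by
  simp only [dualGenerator, particleTransfer_congr h]

theorem dualGenerator_const (c : ℝ) (η : Fin (n + 3) → ℕ) :
    dualGenerator s (fun _ => c) η = 0 := by
  simp [dualGenerator, particleTransfer]

theorem particleTransfer_sum_mul {α : Type*} (S : Finset α) (c : α → ℝ)
    (F : α → (Fin M → ℕ) → ℝ) (a b : Fin M) (η : Fin M → ℕ) :
    particleTransfer s a b (fun x => ∑ ζ ∈ S, c ζ * F ζ x) η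
      = ∑ ζ ∈ S, c ζ * particleTransfer s a b (F ζ) η := by
  simp only [particleTransfer, Finset.mul_sum, ← Finset.sum_sub_distrib]
  rw [Finset.sum_comm]
  exact Finset.sum_congr rfl fun ζ _ => Finset.sum_congr rfl fun k _ => by ring

theorem dualGenerator_sum_mul {α : Type*} (S : Finset α) (c : α → ℝ)
    (F : α → (Fin (n + 3) → ℕ) → ℝ) (η : Fin (n + 3) → ℕ) :
    dualGenerator s (fun x => ∑ ζ ∈ S, c ζ * F ζ x) η
      = ∑ ζ ∈ S, c ζ * dualGenerator s (F ζ) η := by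
  simp only [dualGenerator, particleTransfer_sum_mul, mul_add, Finset.sum_add_distrib,
    Finset.mul_sum]
  congr 3 <;> exact Finset.sum_comm

/-- The configurations of `m` particles. -/
def configurations (M m : ℕ) : Finset (Fin M → ℕ) := Finset.piAntidiag Finset.univ m

theorem mem_configurations {m : ℕ} {x : Fin M → ℕ} : x ∈ configurations M m ↔ ∑ v, x v = m := by
  simp [configurations]

theorem sum_mul_pointMass {m : ℕ} (f : (Fin M → ℕ) → ℝ) {x : Fin M → ℕ}
    (hx : x ∈ configurations M m) : ∑ ζ ∈ configurations M m, f ζ * pointMass ζ x = f x := by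
  simp [pointMass, hx]

theorem dualGenerator_eq_sum {m : ℕ} (f : (Fin (n + 3) → ℕ) → ℝ) {η : Fin (n + 3) → ℕ}
    (hη : η ∈ configurations (n + 3) m) :
    dualGenerator s f η
      = ∑ ζ ∈ configurations (n + 3) m, f ζ * dualGenerator s (pointMass ζ) η := by
  rw [← dualGenerator_sum_mul]
  exact dualGenerator_congr fun x hx =>
    (sum_mul_pointMass f (mem_configurations.2 (hx.trans (mem_configurations.1 hη)))).symm

/-- Valid for every `x`, since the image of a point mass vanishes at other particle numbers. It
gives both the bound needed for Dynkin's formula and the closed forward system. -/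
theorem dualGenerator_pointMass_eq_sum {m : ℕ} {η : Fin (n + 3) → ℕ}
    (hη : η ∈ configurations (n + 3) m) (x : Fin (n + 3) → ℕ) :
    dualGenerator s (pointMass η) x = ∑ ζ ∈ configurations (n + 3) m,
      pointMass ζ x * dualGenerator s (pointMass η) ζ := by
  by_cases hx : x ∈ configurations (n + 3) m
  · simp only [mul_comm (pointMass _ x)]
    rw [sum_mul_pointMass (fun ζ => dualGenerator s (pointMass η) ζ) hx]
  · rw [Finset.sum_eq_zero fun ζ hζ => ?_]
    · rw [← dualGenerator_const (s := s) 0 x]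
      refine dualGenerator_congr fun z hz => if_neg ?_
      rintro rfl
      exact hx (mem_configurations.2 (hz.symm.trans (mem_configurations.1 hη)))
    · rw [pointMass, if_neg (by rintro rfl; exact hx hζ), zero_mul]

variable {Ω : Type*} {mΩ : MeasurableSpace Ω} {Q : Measure Ω} [IsProbabilityMeasure Q]
  {𝒢 : Filtration ℝ≥0 mΩ} {X : ℝ≥0 → Ω → Fin (n + 3) → ℕ} {ξ : Fin (n + 3) → ℕ}

theorem integrable_pointMass {X : Ω → Fin M → ℕ} (hX : Measurable X) (η : Fin M → ℕ) :
    Integrable (fun ω => pointMass η (X ω)) Q :=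
  Integrable.of_bound ((Measurable.of_discrete (f := pointMass η)).comp hX).aestronglyMeasurable 1
    (Eventually.of_forall fun ω => by unfold pointMass; split_ifs <;> simp)

/-- The forward equation of the dual process. -/
theorem IsDualProcess.integral_pointMass (hX : IsDualProcess s Q 𝒢 X ξ) {m : ℕ}
    {η : Fin (n + 3) → ℕ} (hη : η ∈ configurations (n + 3) m) (t : ℝ≥0) :
    ∫ ω, pointMass η (X t ω) ∂Q = pointMass η ξ + ∫ r in (0 : ℝ)..t,
      ∑ ζ ∈ configurations (n + 3) m, (∫ ω, pointMass ζ (X r.toNNReal ω) ∂Q)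
        * dualGenerator s (pointMass η) ζ := by
  have hsupp : (Function.support (pointMass η)).Finite :=
    (Set.finite_singleton η).subset fun x hx => by
      by_contra h
      exact hx (if_neg h)
  have hb : ∀ x, |dualGenerator s (pointMass η) x|
      ≤ ∑ ζ ∈ configurations (n + 3) m, |dualGenerator s (pointMass η) ζ| := fun x => by
    rw [dualGenerator_pointMass_eq_sum hη x]
    refine (Finset.abs_sum_le_sum_abs _ _).trans (Finset.sum_le_sum fun ζ _ => ?_)
    rw [abs_mul]
    refine mul_le_of_le_one_left (abs_nonneg _) ?_
    unfold pointMass; split_ifs <;> simp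
  rw [(IsMartingaleSolution.integral_eq hX (f := pointMass η) hsupp Measurable.of_discrete
    (fun _ _ => rfl) (fun r ω => hb (X r ω)) t).2]
  congr 2
  ext r
  simp only [dualGenerator_pointMass_eq_sum hη (X _ _)]
  rw [integral_finsetSum _ fun ζ _ =>
    (integrable_pointMass (IsMartingaleSolution.measurable hX _) ζ).mul_const _]
  simp only [integral_mul_const]

/-- The pairing of the law of the dual process with a solution of the backward equation. -/
theorem IsDualProcess.sum_integral_pointMass_mul (hX : IsDualProcess s Q 𝒢 X ξ) {m : ℕ}
    (hξ : ξ ∈ configurations (n + 3) m) {h : (Fin (n + 3) → ℕ) → ℝ → ℝ} (t : ℝ≥0)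
    (hhi : ∀ η ∈ configurations (n + 3) m, IntegrableOn (h η) (Set.Icc 0 t))
    (hh : ∀ η ∈ configurations (n + 3) m, ∀ r ∈ Set.Icc (0 : ℝ) t,
      h η r = h η 0 + ∫ r in (0 : ℝ)..r, ∑ ζ ∈ configurations (n + 3) m,
        dualGenerator s (pointMass ζ) η * h ζ r) :
    ∑ η ∈ configurations (n + 3) m, (∫ ω, pointMass η (X t ω) ∂Q) * h η 0 = h ξ t := by
  have hp0 : ∀ η ∈ configurations (n + 3) m,
      ∫ ω, pointMass η (X (0 : ℝ).toNNReal ω) ∂Q = pointMass η ξ := fun η hη => by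
    simpa using hX.integral_pointMass hη 0
  have key := sum_mul_eq_of_linear_systems (configurations (n + 3) m)
    (fun ζ η => dualGenerator s (pointMass η) ζ)
    (p := fun η r => ∫ ω, pointMass η (X r.toNNReal ω) ∂Q) (h := h) t.coe_nonneg
    (fun η _ => IntegrableOn.of_bound (by simp)
      (IsMartingaleSolution.measurable_integral hX Measurable.of_discrete).aestronglyMeasurable 1
      (Eventually.of_forall fun r => (norm_integral_le_of_norm_le_const (C := 1)
        (Eventually.of_forall fun ω => by unfold pointMass; split_ifs <;> simp)).trans
          (by rw [one_mul, probReal_univ])))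
    hhi
    (fun η hη r hr => by
      have := hX.integral_pointMass hη r.toNNReal
      rw [Real.coe_toNNReal r hr.1] at this
      simp only [hp0 η hη, this])
    hh
  simp only [Real.toNNReal_coe] at key
  -- At time `0` the law is concentrated at `ξ`, which leaves the single term `h ξ t`.
  rw [← key, Finset.sum_congr rfl fun η hη => by rw [hp0 η hη]]
  simp only [mul_comm (pointMass _ ξ)]
  exact sum_mul_pointMass (fun η => h η t) hξ

/-- The number of particles is conserved. -/
theorem IsDualProcess.ae_mem_configurations (hX : IsDualProcess s Q 𝒢 X ξ) (t : ℝ≥0) :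
    ∀ᵐ ω ∂Q, X t ω ∈ configurations (n + 3) (∑ v, ξ v) := by
  have hint := fun η => integrable_pointMass (Q := Q)
    (IsMartingaleSolution.measurable hX t) η
  -- The generator annihilates constants, so `h = 1` solves the backward equation and the pairing
  -- says that the configurations with the initial particle number keep total mass `1`.
  have h1 := hX.sum_integral_pointMass_mul (mem_configurations.2 rfl) (h := fun _ _ => 1) t
    (fun η _ => integrableOn_const (by simp)) fun η hη r hr => by
      have := dualGenerator_eq_sum (s := s) (fun _ => 1) hη
      rw [dualGenerator_const] at this
      simp only [one_mul] at this
      simp only [mul_one, ← this, intervalIntegral.integral_zero, add_zero]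
  simp only [mul_one] at h1
  rw [← integral_finsetSum _ fun η _ => hint η] at h1
  have hle : ∀ ω, ∑ η ∈ configurations (n + 3) (∑ v, ξ v), pointMass η (X t ω) ≤ 1 := fun ω => by
    simp only [pointMass, Finset.sum_ite_eq]
    split_ifs <;> simp
  have h2 : ∫ ω, (1 - ∑ η ∈ configurations (n + 3) (∑ v, ξ v), pointMass η (X t ω)) ∂Q = 0 := by
    rw [integral_sub (integrable_const _) (integrable_finsetSum _ fun η _ => hint η), h1]
    simp
  rw [integral_eq_zero_iff_of_nonneg (fun ω => sub_nonneg.2 (hle ω))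
    ((integrable_const _).sub (integrable_finsetSum _ fun η _ => hint η))] at h2
  filter_upwards [h2] with ω hω
  by_contra hmem
  simp [pointMass, hmem] at hω

/-- Almost surely the process sits in a finite set, so any `f` is there a finite combination of
point masses, which settles integrability too. -/
theorem IsDualProcess.integral_eq_sum (hX : IsDualProcess s Q 𝒢 X ξ) (t : ℝ≥0)
    (f : (Fin (n + 3) → ℕ) → ℝ) :
    Integrable (fun ω => f (X t ω)) Q ∧
      ∫ ω, f (X t ω) ∂Q = ∑ η ∈ configurations (n + 3) (∑ v, ξ v),
        (∫ ω, pointMass η (X t ω) ∂Q) * f η := by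
  have hint := fun η => integrable_pointMass (Q := Q)
    (IsMartingaleSolution.measurable hX t) η
  have hae : (fun ω => ∑ η ∈ configurations (n + 3) (∑ v, ξ v), f η * pointMass η (X t ω))
      =ᵐ[Q] fun ω => f (X t ω) := by
    filter_upwards [hX.ae_mem_configurations t] with ω hω using sum_mul_pointMass f hω
  refine ⟨(integrable_finsetSum _ fun η _ => (hint η).const_mul _).congr hae, ?_⟩
  rw [← integral_congr_ae hae, integral_finsetSum _ fun η _ => (hint η).const_mul _]
  exact Finset.sum_congr rfl fun η _ => by rw [integral_const_mul, mul_comm]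

end DualProcess

/-! ### The duality theorem -/

/-- Duality between the heat conduction model with `N = n + 1` sites and the absorbing dual
process.  The integrability of the two random variables is part of the claim. -/
theorem theorem4 (n : ℕ) (s lamL lamR : ℝ) (hs : 0 < s) (hL : 0 < lamL) (hR : 0 < lamR)
    (y : Fin (n + 1) → ℝ) (hy : ∀ i, 0 < y i) (ξ : Fin (n + 3) → ℕ)
    {Ω : Type*} {mΩ : MeasurableSpace Ω} (P : Measure Ω) [IsProbabilityMeasure P]
    (ℱ : Filtration ℝ≥0 mΩ) (Y : ℝ≥0 → Ω → Fin (n + 1) → ℝ)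
    (hY : IsHeatProcess s lamL lamR P ℱ Y y)
    {Ω' : Type*} {mΩ' : MeasurableSpace Ω'} (Q : Measure Ω') [IsProbabilityMeasure Q]
    (𝒢 : Filtration ℝ≥0 mΩ') (X : ℝ≥0 → Ω' → Fin (n + 3) → ℕ)
    (hX : IsDualProcess s Q 𝒢 X ξ) (t : ℝ≥0) :
    Integrable (fun ω => dualityFunction s lamL lamR (Y t ω) ξ) P ∧
      Integrable (fun ω => dualityFunction s lamL lamR y (X t ω)) Q ∧
      ∫ ω, dualityFunction s lamL lamR (Y t ω) ξ ∂P
        = ∫ ω, dualityFunction s lamL lamR y (X t ω) ∂Q := by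
  -- Any positive exponent below both reservoir parameters would do.
  have hθ : 0 < min lamL lamR / 2 := half_pos (lt_min hL hR)
  have hθL : min lamL lamR / 2 < lamL := (half_lt_self (lt_min hL hR)).trans_le (min_le_left _ _)
  have hθR : min lamL lamR / 2 < lamR := (half_lt_self (lt_min hL hR)).trans_le (min_le_right _ _)
  have hdyn := fun η => dynkin_of_polyLipschitz (fun c => isJumpChannel_heat hs hθL hθR c) hθ
    (heatGenerator_eq_jumpSum s lamL lamR) hY.pos hY.solution (fun i => (hy i).le)
    (contDiff_dualityFunction (s := s) (lamL := lamL) (lamR := lamR) (ξ := η))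
    polyLipschitz_dualityFunction
  -- Duality of the generators closes Dynkin's formula: the expectations over one particle number
  -- satisfy a finite linear system, the backward equation.
  have hback : ∀ η ∈ configurations (n + 3) (∑ v, ξ v), ∀ r : ℝ≥0,
      ∫ ω, dualityFunction s lamL lamR (Y r ω) η ∂P = dualityFunction s lamL lamR y η
        + ∫ r in (0 : ℝ)..r, ∑ ζ ∈ configurations (n + 3) (∑ v, ξ v),
          dualGenerator s (pointMass ζ) η
            * ∫ ω, dualityFunction s lamL lamR (Y r.toNNReal ω) ζ ∂P := by
    intro η hη r
    rw [(hdyn η r).2.2]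
    congr 2
    ext u
    simp only [jumpSum_dualityFunction hs hL hR,
      dualGenerator_eq_sum (dualityFunction s lamL lamR (Y _ _)) hη]
    rw [integral_finsetSum _ fun ζ _ => (hdyn ζ _).1.mul_const _]
    exact Finset.sum_congr rfl fun ζ _ => by rw [integral_mul_const, mul_comm]
  have hzero : ∀ η ∈ configurations (n + 3) (∑ v, ξ v),
      ∫ ω, dualityFunction s lamL lamR (Y (0 : ℝ).toNNReal ω) η ∂P
        = dualityFunction s lamL lamR y η := fun η hη => by
    simpa using hback η hη 0
  have hpair := IsDualProcess.sum_integral_pointMass_mul hX (mem_configurations.2 rfl)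
    (h := fun η r => ∫ ω, dualityFunction s lamL lamR (Y r.toNNReal ω) η ∂P) t
    (fun η _ => (hdyn η t).2.1) fun η hη r hr => by
      have := hback η hη r.toNNReal
      rw [Real.coe_toNNReal r hr.1] at this
      rw [hzero η hη, this]
  obtain ⟨hint, hsum⟩ := IsDualProcess.integral_eq_sum hX t (dualityFunction s lamL lamR y)
  refine ⟨(hdyn ξ t).1, hint, ?_⟩
  rw [Real.toNNReal_coe] at hpair
  rw [hsum, ← hpair]
  exact Finset.sum_congr rfl fun η hη => by rw [hzero η hη]
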